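/- **Setting.** Let $\mathcal H$ be a complex Hilbert space and $\Phi\subset\mathcal H\subset\Phi',\Phi^\times$ a rigged Hilbert space: $\Phi$ is a dense linear subspace of $\mathcal H$ with a nuclear (locally convex) topology for which the inclusion is continuous; $\Phi'$ and $\Phi^\times$ are the spaces of continuous linear, resp. antilinear, functionals on $\Phi$. The topologies are compatible: a Cauchy net of $\Phi$ that tends to $0$ in $\mathcal H$ tends to $0$ in $\Phi$ (automatic if $\Phi$ is complete). Let $\Phi\hat\otimes\Phi$ be the completion of $\Phi\otimes\Phi$ for the projective topology (local base: the convex circled hulls $\Gamma(V\otimes V)$, $V$ a $0$-neighbourhood of $\Phi$), $\mathcal H\bar\otimes\mathcal H$ the Hilbert space tensor product, $C$ a conjugation on $\mathcal H$ (antilinear, isometric, $C^2=I$) that maps $\Phi$ continuously onto $\Phi$, and $\mathcal L(\mathcal H)$ the Liouville space of Hilbert–Schmidt operators with $\langle A,B\rangle_{\mathcal L}=\operatorname{Tr}A^\dagger B$. Let $I_C:\mathcal H\bar\otimes\mathcal H\to\mathcal L(\mathcal H)$ be the unitary operator with $I_C(\varphi\otimes C\psi)=\langle\psi,\cdot\rangle\varphi$,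 and let $\Phi_{\mathcal L}=I_C(\Phi\hat\otimes\Phi)$ carry the topology transported by $I_C$. Let $\eta$ be a bounded, positive, injective operator on $\mathcal H$ with $C\eta=\eta C$ that restricts to a linear homeomorphism of $\Phi$ onto $\Phi$. Let $H:D(H)\to\mathcal H$ be a linear operator with $\Phi\subset D(H)$, $H\Phi\subset\Phi$, $H$ continuous on $\Phi$, that is $\eta$-quasi-Hermitian: $H^\dagger=\eta H\eta^{-1}$, with $\eta D(H)=D(H^\dagger)$. Put $$L=\overline{H\otimes I-I\otimes CHC}\ \text{ in }\mathcal H\bar\otimes\mathcal H,\qquad \mathcal L_H=I_CLI_C^{-1},\qquad \zeta=I_C(\eta\otimes\eta)I_C^{-1}.$$ An operator $A$ that maps one of the spaces $E=\Phi,\ \Phi\hat\otimes\Phi,\ \Phi_{\mathcal L}$ continuously into itself is extended to $E'\cup E^\times$ by $(\hat A f)(x)=f(Ax)$, and $(\hat Cf)(x)=f(Cx)$, which exchanges $\Phi'$ and $\Phi^\times$. Let $\overline{\hat H^\dagger\otimes\hat I-\hat I\otimes\hat C\hat H^\dagger\hat C}$ denote the operator $f\mapsto f\circ(H^\dagger\otimes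 I-I\otimes CH^\dagger C)$ on $(\Phi\hat\otimes\Phi)'\cup(\Phi\hat\otimes\Phi)^\times$, where $H^\dagger\otimes I-I\otimes CH^\dagger C$ stands for the continuous extension to $\Phi\hat\otimes\Phi$ of this operator on $\Phi\otimes\Phi$. **Claim.** The canonical map $\Phi\hat\otimes\Phi\to\mathcal H\bar\otimes\mathcal H$ is injective. The operator $H^\dagger$ maps $\Phi$, the operators $L$, $L^\dagger$, $\eta\otimes\eta$ map $\Phi\hat\otimes\Phi$, and the operators $\mathcal L_H$, $\mathcal L_H^\dagger$, $\zeta$ map $\Phi_{\mathcal L}$ continuously into itself, so that they all have extensions to the dual spaces. These satisfy: 1. On $(\Phi\hat\otimes\Phi)'\cup(\Phi\hat\otimes\Phi)^\times$, $$\hat L^\dagger=\overline{\hat H^\dagger\otimes\hat I-\hat I\otimes\hat C\hat H^\dagger\hat C}$$ (equality, not only inclusion), and for $f,g$ both in $\Phi'$ or both in $\Phi^\times$, $\hat L^\dagger(f\otimes g)=\hat H^\dagger f\otimes g-f\otimes\hat C\hat H^\dagger\hat C g$. 2. $\widehat{\eta\otimes\eta}$ is invertible on $(\Phi\hat\otimes\Phi)'\cup(\Phi\hat\otimes\Phi)^\times$,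 and $$\hat L^\dagger=\widehat{\eta\otimes\eta}\;\hat L\;\widehat{\eta\otimes\eta}^{\,-1}.$$ 3. $\hat\zeta$ is invertible on $\Phi_{\mathcal L}'\cup\Phi_{\mathcal L}^\times$, and $$\hat{\mathcal L}_H^\dagger=\hat\zeta\,\hat{\mathcal L}_H\,\hat\zeta^{-1}.$$ In 2 and 3 operators are written to the right of the functional on which they act, as for bras: $f\hat L^\dagger=((f\,\widehat{\eta\otimes\eta})\hat L)\,\widehat{\eta\otimes\eta}^{\,-1}$, where $f\hat A:=\hat A(f)=f\circ A$. As a composition of maps, with the rightmost map applied first, the relations read $\hat L^\dagger=\widehat{\eta\otimes\eta}^{\,-1}\circ\hat L\circ\widehat{\eta\otimes\eta}$ and $\hat{\mathcal L}_H^\dagger=\hat\zeta^{-1}\circ\hat{\mathcal L}_H\circ\hat\zeta$. -/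

import Mathlib

open scoped TensorProduct Topology Pointwise

noncomputable section

namespace RiggedLiouville

section ProjectiveTensorProduct

/-- The algebraic tensor product `Φ ⊗ Φ`, as a type that carries the projective topology. -/
def ProjTensor (Φ : Type*) [AddCommGroup Φ] [Module ℂ Φ] : Type _ := Φ ⊗[ℂ] Φ

variable {Φ : Type*} [AddCommGroup Φ] [Module ℂ Φ]

instance : AddCommGroup (ProjTensor Φ) := inferInstanceAs (AddCommGroup (Φ ⊗[ℂ] Φ))

instance : Module ℂ (ProjTensor Φ) := inferInstanceAs (Module ℂ (Φ ⊗[ℂ] Φ))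

/-- The elementary tensor `a ⊗ b`. -/
def ProjTensor.tmul (a b : Φ) : ProjTensor Φ := a ⊗ₜ[ℂ] b

/-- `Γ(V ⊗ V)`: the convex circled hull of the set of all `a ⊗ b` with `a, b ∈ V`. -/
def tensorHull (V : Set Φ) : Set (ProjTensor Φ) :=
  convexHull ℝ (balancedHull ℂ (Set.image2 ProjTensor.tmul V V))

theorem balanced_convexHull_real {E : Type*} [AddCommGroup E] [Module ℂ E] {s : Set E}
    (hs : Balanced ℂ s) : Balanced ℂ (convexHull ℝ s) := by
  rw [balanced_iff_smul_mem] at hs ⊢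
  intro a ha x hx
  have hc : Convex ℝ {y : E | a • y ∈ convexHull ℝ s} := by
    intro y hy z hz u v hu hv huv
    have := convex_convexHull ℝ s hy hz hu hv huv
    simpa [smul_add, smul_comm a u y, smul_comm a v z] using this
  exact convexHull_min (fun y hy => (subset_convexHull ℝ s (hs ha hy) : a • y ∈ _)) hc hx

theorem tensorHull_mono {V W : Set Φ} (h : V ⊆ W) : tensorHull V ⊆ tensorHull W := by
  apply convexHull_mono
  apply (balancedHull.balanced _).balancedHull_subset_of_subset
  exact (Set.image2_subset h h).trans (subset_balancedHull ℂ)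

theorem convex_tensorHull (V : Set Φ) : Convex ℝ (tensorHull V) := convex_convexHull ℝ _

theorem balanced_tensorHull (V : Set Φ) : Balanced ℂ (tensorHull V) :=
  balanced_convexHull_real (balancedHull.balanced _)

theorem tmul_mem_tensorHull {V : Set Φ} {a b : Φ} (ha : a ∈ V) (hb : b ∈ V) :
    ProjTensor.tmul a b ∈ tensorHull V :=
  subset_convexHull ℝ _ (subset_balancedHull ℂ (Set.mem_image2_of_mem ha hb))

theorem tensorHull_subset {V : Set Φ} {S : Set (ProjTensor Φ)} (hc : Convex ℝ S)
    (hb : Balanced ℂ S) (h : ∀ a ∈ V, ∀ b ∈ V, ProjTensor.tmul a b ∈ S) : tensorHull V ⊆ S := by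
  refine convexHull_min (hb.balancedHull_subset_of_subset ?_) hc
  rintro _ ⟨a, ha, b, hb, rfl⟩
  exact h a ha b hb

variable [TopologicalSpace Φ] [ContinuousSMul ℂ Φ]

theorem exists_smul_tensorHull_subset (V : Set Φ) (hV : V ∈ 𝓝 (0 : Φ)) (c : ℂ) :
    ∃ W ∈ 𝓝 (0 : Φ), ∀ x ∈ tensorHull W, c • x ∈ tensorHull V := by
  have h : (fun x : Φ => c • x) ⁻¹' V ∈ 𝓝 (0 : Φ) :=
    (continuous_const_smul c).continuousAt.preimage_mem_nhds (by simpa using hV)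
  refine ⟨_, Filter.inter_mem hV h, ?_⟩
  apply tensorHull_subset (S := {x | c • x ∈ tensorHull V})
  · intro x hx y hy s t hs ht hst
    have := convex_tensorHull V hx hy hs ht hst
    simpa [smul_add, smul_comm c s x, smul_comm c t y] using this
  · rintro k hk _ ⟨x, hx, rfl⟩
    have := balanced_tensorHull V k hk (Set.smul_mem_smul_set hx)
    simpa [smul_comm c k x] using this
  · rintro a ⟨-, ha⟩ b ⟨hb, -⟩
    exact tmul_mem_tensorHull (V := V) ha hb

theorem absorbs_tensorHull (x : ProjTensor Φ) :
    ∀ V ∈ 𝓝 (0 : Φ), ∀ᶠ c : ℂ in 𝓝 0, c • x ∈ tensorHull V := by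
  have key : ∀ (V : Set Φ), V ∈ 𝓝 (0 : Φ) → ∀ a : Φ, ∃ r : ℂ, r ≠ 0 ∧ r • a ∈ V := by
    intro V hV a
    have h : ∀ᶠ r : ℂ in 𝓝 0, r • a ∈ V :=
      (continuous_id.smul continuous_const).continuousAt.preimage_mem_nhds (by simpa using hV)
    have h' : ∀ᶠ r : ℂ in 𝓝[≠] 0, r ≠ 0 ∧ r • a ∈ V :=
      (eventually_mem_nhdsWithin).and (h.filter_mono nhdsWithin_le_nhds)
    exact h'.exists
  induction x using TensorProduct.induction_on with
  | zero =>
    intro V hV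
    refine Filter.Eventually.of_forall fun c => ?_
    have h0 : (0 : Φ) ∈ V := mem_of_mem_nhds hV
    have := tmul_mem_tensorHull h0 h0
    have e : ProjTensor.tmul (0 : Φ) 0 = 0 := TensorProduct.zero_tmul _ _
    rw [e] at this
    have e2 : c • (0 : ProjTensor Φ) = 0 := smul_zero c
    exact (congrArg (· ∈ tensorHull V) e2).mpr this
  | tmul a b =>
    intro V hV
    obtain ⟨r, hr, hra⟩ := key V hV a
    have h : ∀ᶠ c : ℂ in 𝓝 0, (c * r⁻¹) • b ∈ V :=
      ((continuous_id.mul continuous_const).smul continuous_const).continuousAt.preimage_mem_nhds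
        (by simpa using hV)
    filter_upwards [h] with c hc
    have := tmul_mem_tensorHull hra hc
    have e : ProjTensor.tmul (r • a) ((c * r⁻¹) • b) = c • ProjTensor.tmul a b := by
      change (r • a) ⊗ₜ[ℂ] ((c * r⁻¹) • b) = c • (a ⊗ₜ[ℂ] b)
      rw [TensorProduct.smul_tmul_smul]
      congr 1
      field_simp
    rw [e] at this
    exact this
  | add x y hx hy =>
    intro V hV
    obtain ⟨W, hW, hWV⟩ := exists_smul_tensorHull_subset V hV 2
    filter_upwards [hx W hW, hy W hW] with c h1 h2
    have := convex_tensorHull V (hWV _ h1) (hWV _ h2) (by norm_num : (0:ℝ) ≤ 1/2)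
      (by norm_num : (0:ℝ) ≤ 1/2) (by norm_num)
    have e : ∀ z : ProjTensor Φ, (1/2 : ℝ) • (2 : ℂ) • z = z := by
      intro z
      rw [← Complex.coe_smul, smul_smul]
      norm_num
    rw [e, e] at this
    have e2 : c • (show ProjTensor Φ from x + y) =
      c • (show ProjTensor Φ from x) + c • (show ProjTensor Φ from y) := smul_add c _ _
    exact (congrArg (· ∈ tensorHull V) e2).mpr this

variable (Φ) in
/-- The projective topology of `Φ ⊗ Φ`: the sets `Γ(V ⊗ V)`, `V` a neighbourhood of `0` in `Φ`,
form a local base. -/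
def projBasis : ModuleFilterBasis ℂ (ProjTensor Φ) where
  sets := {U | ∃ V ∈ 𝓝 (0 : Φ), U = tensorHull V}
  nonempty := ⟨_, Set.univ, Filter.univ_mem, rfl⟩
  inter_sets := by
    rintro _ _ ⟨V, hV, rfl⟩ ⟨W, hW, rfl⟩
    exact ⟨_, ⟨V ∩ W, Filter.inter_mem hV hW, rfl⟩,
      Set.subset_inter (tensorHull_mono Set.inter_subset_left)
        (tensorHull_mono Set.inter_subset_right)⟩
  zero' := by
    rintro _ ⟨V, hV, rfl⟩
    have := (absorbs_tensorHull (0 : ProjTensor Φ) V hV).self_of_nhds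
    simpa using this
  add' := by
    rintro _ ⟨V, hV, rfl⟩
    obtain ⟨W, hW, hWV⟩ := exists_smul_tensorHull_subset V hV 2
    refine ⟨_, ⟨W, hW, rfl⟩, ?_⟩
    rintro _ ⟨x, hx, y, hy, rfl⟩
    have := convex_tensorHull V (hWV _ hx) (hWV _ hy) (by norm_num : (0:ℝ) ≤ 1/2)
      (by norm_num : (0:ℝ) ≤ 1/2) (by norm_num)
    have e : ∀ z : ProjTensor Φ, (1/2 : ℝ) • (2 : ℂ) • z = z := by
      intro z
      rw [← Complex.coe_smul, smul_smul]
      norm_num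
    rwa [e, e] at this
  neg' := by
    rintro _ ⟨V, hV, rfl⟩
    refine ⟨_, ⟨V, hV, rfl⟩, fun x hx => ?_⟩
    exact (balanced_tensorHull V).neg_mem_iff.mpr hx
  conj' := by
    rintro x₀ _ ⟨V, hV, rfl⟩
    refine ⟨_, ⟨V, hV, rfl⟩, fun x hx => ?_⟩
    simpa using hx
  smul' := by
    rintro _ ⟨V, hV, rfl⟩
    refine ⟨Metric.closedBall 0 1, Metric.closedBall_mem_nhds _ one_pos, _, ⟨V, hV, rfl⟩, ?_⟩
    rintro _ ⟨c, hc, x, hx, rfl⟩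
    exact balanced_tensorHull V c (by simpa using hc) (Set.smul_mem_smul_set hx)
  smul_left' := by
    rintro c _ ⟨V, hV, rfl⟩
    obtain ⟨W, hW, h⟩ := exists_smul_tensorHull_subset V hV c
    exact ⟨_, ⟨W, hW, rfl⟩, h⟩
  smul_right' := by
    rintro x _ ⟨V, hV, rfl⟩
    exact absorbs_tensorHull x V hV

instance : UniformSpace (ProjTensor Φ) := (projBasis Φ).toAddGroupFilterBasis.uniformSpace

instance : IsUniformAddGroup (ProjTensor Φ) := (projBasis Φ).toAddGroupFilterBasis.isUniformAddGroup

instance : ContinuousSMul ℂ (ProjTensor Φ) := (projBasis Φ).continuousSMul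

instance : UniformContinuousConstSMul ℂ (ProjTensor Φ) :=
  uniformContinuousConstSMul_of_continuousConstSMul _ _

theorem projTensor_hasBasis :
    (𝓝 (0 : ProjTensor Φ)).HasBasis (fun V : Set Φ => V ∈ 𝓝 (0 : Φ)) tensorHull := by
  have h := (projBasis Φ).toAddGroupFilterBasis.nhds_zero_hasBasis
  refine ⟨fun t => ?_⟩
  refine (h.mem_iff).trans ⟨?_, ?_⟩
  · rintro ⟨_, ⟨V, hV, rfl⟩, ht⟩
    exact ⟨V, hV, ht⟩
  · rintro ⟨V, hV, ht⟩
    exact ⟨_, ⟨V, hV, rfl⟩, ht⟩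

instance : LocallyConvexSpace ℝ (ProjTensor Φ) :=
  LocallyConvexSpace.ofBasisZero ℝ _ _ _ projTensor_hasBasis fun V _ => convex_tensorHull V

/-- A semilinear map on `Φ ⊗ Φ` with values in a locally convex space is continuous as soon as
`(a, b) ↦ u (a ⊗ b)` is continuous at `(0, 0)`. -/
theorem continuous_of_tmul {σ : ℂ →+* ℂ} [RingHomIsometric σ] {G : Type*} [AddCommGroup G]
    [Module ℂ G] [TopologicalSpace G] [IsTopologicalAddGroup G] [ContinuousSMul ℂ G]
    [LocallyConvexSpace ℝ G] (u : ProjTensor Φ →ₛₗ[σ] G)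
    (h : ∀ U ∈ 𝓝 (0 : G), ∃ V ∈ 𝓝 (0 : Φ), ∀ a ∈ V, ∀ b ∈ V, u (ProjTensor.tmul a b) ∈ U) :
    Continuous u := by
  refine continuous_of_continuousAt_zero u ?_
  rw [ContinuousAt, map_zero, projTensor_hasBasis.tendsto_iff
    (LocallyConvexSpace.convex_basis_zero ℝ G)]
  rintro U ⟨hU, hUc⟩
  obtain ⟨V, hV, hVU⟩ := h (balancedCore ℂ U) (balancedCore_mem_nhds_zero hU)
  refine ⟨V, hV, ?_⟩
  have hb : Balanced ℂ (convexHull ℝ (balancedCore ℂ U)) :=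
    balanced_convexHull_real (balancedCore_balanced U)
  have hsub : convexHull ℝ (balancedCore ℂ U) ⊆ U := convexHull_min (balancedCore_subset U) hUc
  have hreal : ∀ (s : ℝ) x, u (s • x) = s • u x := by
    intro s x
    have h1 : σ (s : ℂ) = s := by
      have := map_real_smul σ (AddMonoidHomClass.isometry_of_norm σ (fun z => by simp)).continuous
        s (1 : ℂ)
      simpa using this
    rw [← Complex.coe_smul, map_smulₛₗ, h1, Complex.coe_smul]
  suffices tensorHull V ⊆ {x | u x ∈ convexHull ℝ (balancedCore ℂ U)} from
    fun x hx => hsub (this hx)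
  apply tensorHull_subset
  · intro x hx y hy s t hs ht hst
    have := convex_convexHull ℝ (balancedCore ℂ U) hx hy hs ht hst
    simpa [hreal] using this
  · rintro k hk _ ⟨x, hx, rfl⟩
    have := hb (σ k) (by simpa using hk) (Set.smul_mem_smul_set hx)
    simpa using this
  · intro a ha b hb
    exact subset_convexHull ℝ _ (hVU a ha b hb)


variable (Φ) in
/-- `Φ ⊗̂ Φ`, the completion of `Φ ⊗ Φ` for the projective topology. -/
abbrev CompletedTensor : Type _ := UniformSpace.Completion (ProjTensor Φ)

/-- `A ⊗ B` on `Φ ⊗̂ Φ`, for continuous linear operators `A`, `B` on `Φ`. -/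
def tensorMap (A B : Φ →L[ℂ] Φ) : CompletedTensor Φ →L[ℂ] CompletedTensor Φ :=
  ContinuousLinearMap.completion (α := ProjTensor Φ) (β := ProjTensor Φ)
    { toLinearMap := (TensorProduct.map (A : Φ →ₗ[ℂ] Φ) (B : Φ →ₗ[ℂ] Φ) :
        ProjTensor Φ →ₗ[ℂ] ProjTensor Φ)
      cont := by
        refine continuous_of_tmul _ fun U hU => ?_
        obtain ⟨V, hV, hVU⟩ := projTensor_hasBasis.mem_iff.mp hU
        refine ⟨A ⁻¹' V ∩ B ⁻¹' V, Filter.inter_mem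
          (A.continuous.continuousAt.preimage_mem_nhds (by simpa using hV))
          (B.continuous.continuousAt.preimage_mem_nhds (by simpa using hV)), ?_⟩
        rintro a ⟨ha, -⟩ b ⟨-, hb⟩
        exact hVU (tmul_mem_tensorHull ha hb) }

/-- `f ⊗ g` on `Φ ⊗̂ Φ`: the continuous functional with `(f ⊗ g) (a ⊗ b) = f a * g b`, for `f`, `g`
both linear (`σ = id`) or both antilinear (`σ` = complex conjugation). -/
def tensorFunctional {σ : ℂ →+* ℂ} [RingHomIsometric σ] (f g : Φ →SL[σ] ℂ) :
    CompletedTensor Φ →SL[σ] ℂ :=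
  ContinuousLinearMap.fromCompletion (α := ProjTensor Φ) (β := ℂ)
    { toLinearMap := (TensorProduct.lift (LinearMap.mk₂'ₛₗ σ σ (fun a b => f a * g b)
        (fun a a' b => by simp [add_mul]) (fun c a b => by simp [mul_assoc])
        (fun a b b' => by simp [mul_add]) (fun c a b => by simp [mul_left_comm])) :
        ProjTensor Φ →ₛₗ[σ] ℂ)
      cont := by
        refine continuous_of_tmul _ fun U hU => ?_
        have h : Filter.Tendsto (fun p : Φ × Φ => f p.1 * g p.2) (𝓝 (0, 0)) (𝓝 0) := by
          have hc : Continuous fun p : Φ × Φ => f p.1 * g p.2 := by fun_prop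
          simpa using hc.tendsto (0, 0)
        obtain ⟨V, hV, W, hW, hVW⟩ := mem_nhds_prod_iff.mp (h hU)
        refine ⟨V ∩ W, Filter.inter_mem hV hW, ?_⟩
        rintro a ⟨ha, -⟩ b ⟨-, hb⟩
        exact hVW (Set.mk_mem_prod ha hb) }

end ProjectiveTensorProduct

section HilbertTensorProduct

variable (H : Type*) [NormedAddCommGroup H] [InnerProductSpace ℂ H]

/-- `H ⊗̄ H`, the Hilbert space completion of the algebraic tensor product with the inner product
`⟪a ⊗ b, a' ⊗ b'⟫ = ⟪a, a'⟫ ⟪b, b'⟫`. -/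
abbrev HilbertTensor : Type _ := UniformSpace.Completion (H ⊗[ℂ] H)

variable {H}

/-- `A ⊗ B` on `H ⊗̄ H` for bounded operators `A`, `B`. -/
def hilbertTensorMap (A B : H →L[ℂ] H) : HilbertTensor H →L[ℂ] HilbertTensor H :=
  (TensorProduct.mapL A B).completion

/-- The canonical map `Φ ⊗̂ Φ → H ⊗̄ H`, `a ⊗ b ↦ ι a ⊗ ι b`. -/
def tensorEmbedding {Φ : Type*} [AddCommGroup Φ] [Module ℂ Φ] [TopologicalSpace Φ]
    [ContinuousSMul ℂ Φ] (ι : Φ →L[ℂ] H) : CompletedTensor Φ →L[ℂ] HilbertTensor H :=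
  ContinuousLinearMap.completion (α := ProjTensor Φ) (β := H ⊗[ℂ] H)
    { toLinearMap := (TensorProduct.map (ι : Φ →ₗ[ℂ] H) (ι : Φ →ₗ[ℂ] H) :
        ProjTensor Φ →ₗ[ℂ] H ⊗[ℂ] H)
      cont := by
        refine continuous_of_tmul _ fun U hU => ?_
        have h : Filter.Tendsto (fun p : Φ × Φ => ι p.1 ⊗ₜ[ℂ] ι p.2) (𝓝 (0, 0)) (𝓝 0) := by
          have hc : Continuous fun p : Φ × Φ => ι p.1 ⊗ₜ[ℂ] ι p.2 :=
            TensorProduct.continuous_tmul.comp (f := fun p : Φ × Φ => (ι p.1, ι p.2)) (by fun_prop)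
          simpa using hc.tendsto (0, 0)
        obtain ⟨V, hV, W, hW, hVW⟩ := mem_nhds_prod_iff.mp (h hU)
        refine ⟨V ∩ W, Filter.inter_mem hV hW, ?_⟩
        rintro a ⟨ha, -⟩ b ⟨-, hb⟩
        exact hVW (Set.mk_mem_prod ha hb) }

/-- `A ⊗ I - I ⊗ B` for partially defined operators `A`, `B` on `H`, with domain the algebraic
tensor product `D(A) ⊗ D(B)` inside `H ⊗̄ H`. -/
def tensorDiff (A B : H →ₗ.[ℂ] H) : HilbertTensor H →ₗ.[ℂ] HilbertTensor H :=
  let incl : A.domain ⊗[ℂ] B.domain →ₗ[ℂ] HilbertTensor H :=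
    (UniformSpace.Completion.toComplₗᵢ (𝕜 := ℂ) (E := H ⊗[ℂ] H)).toLinearMap ∘ₗ
      TensorProduct.map A.domain.subtype B.domain.subtype
  have hincl : Function.Injective incl :=
    (UniformSpace.Completion.toComplₗᵢ (𝕜 := ℂ) (E := H ⊗[ℂ] H)).injective.comp
      (TensorProduct.map_injective_of_flat_flat _ _ A.domain.injective_subtype
        B.domain.injective_subtype)
  { domain := LinearMap.range incl
    toFun := (UniformSpace.Completion.toComplₗᵢ (𝕜 := ℂ) (E := H ⊗[ℂ] H)).toLinearMap ∘ₗ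
      (TensorProduct.map A.toFun B.domain.subtype - TensorProduct.map A.domain.subtype B.toFun) ∘ₗ
      (LinearEquiv.ofInjective incl hincl).symm.toLinearMap }

theorem conjugation_inner (C : H ≃ₗᵢ⋆[ℂ] H) (x y : H) : inner ℂ (C x) (C y) = inner ℂ y x := by
  have h1 : ∀ x y : H, (inner ℂ (C x) (C y)).re = (inner ℂ x y).re := by
    intro x y
    have e := re_inner_eq_norm_add_mul_self_sub_norm_sub_mul_self_div_four (𝕜 := ℂ) (C x) (C y)
    have e' := re_inner_eq_norm_add_mul_self_sub_norm_sub_mul_self_div_four (𝕜 := ℂ) x y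
    rw [← map_add, ← map_sub, C.norm_map, C.norm_map] at e
    exact e.trans e'.symm
  have e : inner ℂ y x = starRingEnd ℂ (inner ℂ x y) := (inner_conj_symm y x).symm
  rw [e]
  apply Complex.ext
  · rw [Complex.conj_re]
    exact h1 x y
  · have := h1 (Complex.I • x) y
    simp only [map_smulₛₗ, inner_smul_left, Complex.conj_I, map_neg] at this
    simp only [Complex.mul_re, Complex.neg_re, Complex.neg_im, Complex.I_re, Complex.I_im] at this
    rw [Complex.conj_im]
    linarith

/-- `C T C` for a conjugation `C`, with domain `{x | C x ∈ D(T)}`. -/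
def conjugate (C : H ≃ₗᵢ⋆[ℂ] H) (T : H →ₗ.[ℂ] H) : H →ₗ.[ℂ] H where
  domain := T.domain.comap (C.toLinearEquiv : H →ₗ⋆[ℂ] H)
  toFun :=
    { toFun := fun x => C (T ⟨C x, x.2⟩)
      map_add' := fun x y => by
        rw [← map_add, ← T.map_add]
        congr 2
        simp
      map_smul' := fun c x => by
        have : (⟨C (c • x : H), (c • x).2⟩ : T.domain) = starRingEnd ℂ c • ⟨C x, x.2⟩ := by
          ext; simp [map_smulₛₗ]
        simp only [Submodule.coe_smul] at this ⊢
        rw [this, T.map_smul]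
        simp [map_smulₛₗ] }

/-- `L`, the closure of `T ⊗ I - I ⊗ C T C` in `H ⊗̄ H`. -/
def liouvilleTensor (C : H ≃ₗᵢ⋆[ℂ] H) (T : H →ₗ.[ℂ] H) :
    HilbertTensor H →ₗ.[ℂ] HilbertTensor H :=
  (tensorDiff T (conjugate C T)).closure

end HilbertTensorProduct

section HilbertSchmidt

variable (H : Type*) [NormedAddCommGroup H] [InnerProductSpace ℂ H] [CompleteSpace H]

/-- The index set of a chosen orthonormal basis of `H`. -/
def BasisIndex : Type _ := (exists_hilbertBasis ℂ H).choose

/-- A chosen orthonormal basis `(φ_i)` of `H`. -/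
def chosenBasis : HilbertBasis (BasisIndex H) ℂ H := (exists_hilbertBasis ℂ H).choose_spec.choose

/-- The Hilbert-Schmidt operators: the bounded `A` with `∑ ‖A φ_i‖ ^ 2 < ∞`. -/
def hilbertSchmidt : Submodule ℂ (H →L[ℂ] H) where
  carrier := {A | Memℓp (fun i => A (chosenBasis H i)) 2}
  zero_mem' := zero_memℓp
  add_mem' hA hB := hA.add hB
  smul_mem' c _ hA := hA.const_smul c

/-- The Liouville space `𝓛(H)` of Hilbert-Schmidt operators on `H`. -/
def LiouvilleSpace : Type _ := hilbertSchmidt H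

instance : AddCommGroup (LiouvilleSpace H) := inferInstanceAs (AddCommGroup (hilbertSchmidt H))

instance : Module ℂ (LiouvilleSpace H) := inferInstanceAs (Module ℂ (hilbertSchmidt H))

variable {H}

/-- The bounded operator underlying an element of the Liouville space. -/
def LiouvilleSpace.toCLM (A : LiouvilleSpace H) : H →L[ℂ] H := A.1

variable (H) in
/-- `A ↦ (A φ_i)_i`, with values in `ℓ²`. -/
def LiouvilleSpace.columns :
    LiouvilleSpace H →ₗ[ℂ] lp (fun _ : BasisIndex H => H) 2 where
  toFun A := ⟨fun i => A.toCLM (chosenBasis H i), A.2⟩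
  map_add' _ _ := rfl
  map_smul' _ _ := rfl

theorem LiouvilleSpace.columns_injective : Function.Injective (columns H) := by
  intro A B h
  refine Subtype.ext (ContinuousLinearMap.ext_on
    (Submodule.dense_iff_topologicalClosure_eq_top.mpr (chosenBasis H).dense_span) ?_)
  rintro _ ⟨i, rfl⟩
  exact congrFun (congrArg Subtype.val h) i

/-- `⟪A, B⟫ = Tr (A† B) = ∑ ⟪A φ_i, B φ_i⟫`. -/
instance : Inner ℂ (LiouvilleSpace H) :=
  ⟨fun A B => ∑' i, inner ℂ (A.toCLM (chosenBasis H i)) (B.toCLM (chosenBasis H i))⟩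

theorem LiouvilleSpace.inner_eq (A B : LiouvilleSpace H) :
    inner ℂ A B = inner ℂ (columns H A) (columns H B) := rfl

/-- The axioms of an inner product hold for `Tr (A† B)`. -/
@[reducible]
def LiouvilleSpace.core : InnerProductSpace.Core ℂ (LiouvilleSpace H) where
  conj_inner_symm A B := by simp only [LiouvilleSpace.inner_eq, inner_conj_symm]
  re_inner_nonneg A := by simpa only [LiouvilleSpace.inner_eq] using inner_self_nonneg
  add_left A B D := by simp only [LiouvilleSpace.inner_eq, map_add, inner_add_left]
  smul_left A B c := by simp only [LiouvilleSpace.inner_eq, map_smul, inner_smul_left]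
  definite A h := LiouvilleSpace.columns_injective (by
    simpa only [LiouvilleSpace.inner_eq, inner_self_eq_zero, map_zero] using h)

instance : NormedAddCommGroup (LiouvilleSpace H) :=
  @InnerProductSpace.Core.toNormedAddCommGroup ℂ _ _ _ _ LiouvilleSpace.core

instance : InnerProductSpace ℂ (LiouvilleSpace H) := .ofCore LiouvilleSpace.core.toCore


theorem LiouvilleSpace.columns_surjective : Function.Surjective (columns H) := by
  intro v
  have hs : ∀ x : H, Summable (fun i => ‖inner ℂ (chosenBasis H i) x‖ * ‖v i‖) ∧
      ∑' i, ‖inner ℂ (chosenBasis H i) x‖ * ‖v i‖ ≤ ‖x‖ * ‖v‖ := by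
    intro x
    have hx : ‖(chosenBasis H).repr x‖ = ‖x‖ := LinearIsometryEquiv.norm_map _ _
    have h2 : (0 : ℝ) < (2 : ENNReal).toReal := by norm_num
    have hp : (2 : ENNReal).toReal.HolderConjugate (2 : ENNReal).toReal := by
      norm_num [Real.holderConjugate_iff]
    have h := Real.summable_and_inner_le_Lp_mul_Lq_tsum_of_nonneg hp
      (fun i => norm_nonneg ((chosenBasis H).repr x i)) (fun i => norm_nonneg (v i))
      ((lp.memℓp ((chosenBasis H).repr x)).summable h2) ((lp.memℓp v).summable h2)
    rw [← lp.norm_eq_tsum_rpow h2, ← lp.norm_eq_tsum_rpow h2, hx] at h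
    simpa only [HilbertBasis.repr_apply_apply] using h
  have hs' : ∀ x : H, Summable fun i => inner ℂ (chosenBasis H i) x • v i := fun x =>
    Summable.of_norm (by simpa only [norm_smul] using (hs x).1)
  let A : H →ₗ[ℂ] H :=
    { toFun := fun x => ∑' i, inner ℂ (chosenBasis H i) x • v i
      map_add' := fun x y => by
        rw [← (hs' x).tsum_add (hs' y)]
        simp only [inner_add_right, add_smul]
      map_smul' := fun c x => by
        rw [RingHom.id_apply, ← (hs' x).tsum_const_smul c]
        simp only [inner_smul_right, smul_smul] }
  have hA : ∀ x, ‖A x‖ ≤ ‖v‖ * ‖x‖ := fun x => by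
    have h1 : Summable fun i => ‖inner ℂ (chosenBasis H i) x • v i‖ := by
      simpa only [norm_smul] using (hs x).1
    refine (norm_tsum_le_tsum_norm h1).trans ?_
    simp only [norm_smul]
    rw [mul_comm]
    exact (hs x).2
  have hval : ∀ i, A.mkContinuous ‖v‖ hA (chosenBasis H i) = v i := by
    intro i
    change ∑' j, inner ℂ (chosenBasis H j) (chosenBasis H i) • v j = v i
    rw [tsum_eq_single i]
    · have := (chosenBasis H).orthonormal.1 i
      rw [inner_self_eq_norm_sq_to_K, this]
      simp
    · intro j hj
      rw [(chosenBasis H).orthonormal.2 hj, zero_smul]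
  refine ⟨⟨A.mkContinuous ‖v‖ hA, ?_⟩, ?_⟩
  · change Memℓp (fun i => A.mkContinuous ‖v‖ hA (chosenBasis H i)) 2
    simp only [hval]
    exact lp.memℓp v
  · exact lp.ext (funext hval)

variable (H) in
/-- `A ↦ (A φ_i)_i` as an isometric isomorphism onto `ℓ²`. -/
def LiouvilleSpace.columnsIso :
    LiouvilleSpace H ≃ₗᵢ[ℂ] lp (fun _ : BasisIndex H => H) 2 :=
  LinearIsometryEquiv.ofSurjective
    ((columns H).isometryOfInner fun A B => (LiouvilleSpace.inner_eq A B).symm)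
    LiouvilleSpace.columns_surjective

instance : CompleteSpace (LiouvilleSpace H) :=
  ((LiouvilleSpace.columnsIso H).toIsometryEquiv.completeSpace_iff).mpr inferInstance

/-- The operator `P_{ψ, φ} : x ↦ ⟪ψ, x⟫ φ`. -/
def rankOne (ψ φ : H) : LiouvilleSpace H :=
  ⟨(innerSL ℂ ψ).smulRight φ, by
    have h2 : (0 : ℝ) < (2 : ENNReal).toReal := by norm_num
    refine (memℓp_gen_iff h2).mpr ?_
    have h := ((lp.memℓp ((chosenBasis H).repr ψ)).summable h2).mul_right
      (‖φ‖ ^ (2 : ENNReal).toReal)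
    refine h.congr fun i => ?_
    rw [HilbertBasis.repr_apply_apply, ← Real.mul_rpow (norm_nonneg _) (norm_nonneg _),
      norm_inner_symm, ← norm_smul]
    rfl⟩

theorem rankOne_toCLM (ψ φ x : H) : (rankOne ψ φ).toCLM x = inner ℂ ψ x • φ := rfl

theorem inner_rankOne (ψ φ ψ' φ' : H) :
    inner ℂ (rankOne ψ φ) (rankOne ψ' φ') = inner ℂ φ φ' * inner ℂ ψ' ψ := by
  change ∑' i, inner ℂ ((rankOne ψ φ).toCLM (chosenBasis H i))
    ((rankOne ψ' φ').toCLM (chosenBasis H i)) = _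
  simp only [rankOne_toCLM, inner_smul_left, inner_smul_right, inner_conj_symm]
  rw [← (chosenBasis H).tsum_inner_mul_inner ψ' ψ, ← tsum_mul_left]
  exact tsum_congr fun i => by ring

/-- `I_C` on the algebraic tensor product. -/
def liouvilleIsometryAux (C : H ≃ₗᵢ⋆[ℂ] H) : H ⊗[ℂ] H →ₗ[ℂ] LiouvilleSpace H :=
  TensorProduct.lift (LinearMap.mk₂ ℂ (fun φ χ => rankOne (C.symm χ) φ)
    (fun φ φ' χ => Subtype.ext (by ext x; exact smul_add _ _ _))
    (fun c φ χ => Subtype.ext (by ext x; exact smul_comm _ _ _))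
    (fun φ χ χ' => Subtype.ext (by
      ext x
      change inner ℂ (C.symm (χ + χ')) x • φ = inner ℂ (C.symm χ) x • φ + inner ℂ (C.symm χ') x • φ
      rw [map_add, inner_add_left, add_smul]))
    (fun c φ χ => Subtype.ext (by
      ext x
      change inner ℂ (C.symm (c • χ)) x • φ = c • inner ℂ (C.symm χ) x • φ
      rw [map_smulₛₗ, inner_smul_left, smul_smul]
      simp)))

theorem inner_liouvilleIsometryAux (C : H ≃ₗᵢ⋆[ℂ] H) (x y : H ⊗[ℂ] H) :
    inner ℂ (liouvilleIsometryAux C x) (liouvilleIsometryAux C y) = inner ℂ x y := by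
  induction x using TensorProduct.induction_on with
  | zero => simp
  | add x x' hx hx' => simp only [map_add, inner_add_left, hx, hx']
  | tmul φ χ =>
    induction y using TensorProduct.induction_on with
    | zero => simp
    | add y y' hy hy' => simp only [map_add, inner_add_right, hy, hy']
    | tmul φ' χ' =>
      rw [TensorProduct.inner_tmul]
      refine (inner_rankOne _ _ _ _).trans ?_
      rw [conjugation_inner]

theorem liouvilleIsometryAux_isometry (C : H ≃ₗᵢ⋆[ℂ] H) : Isometry (liouvilleIsometryAux C) :=
  ((liouvilleIsometryAux C).isometryOfInner (inner_liouvilleIsometryAux C)).isometry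

/-- The extension of `I_C` to `H ⊗̄ H`. -/
def liouvilleIsometry (C : H ≃ₗᵢ⋆[ℂ] H) : HilbertTensor H →ₗᵢ[ℂ] LiouvilleSpace H where
  toLinearMap := (ContinuousLinearMap.fromCompletion
    ((liouvilleIsometryAux C).isometryOfInner
      (inner_liouvilleIsometryAux C)).toContinuousLinearMap).toLinearMap
  norm_map' x := by
    refine UniformSpace.Completion.induction_on x
      (isClosed_eq (ContinuousLinearMap.continuous _).norm continuous_norm) fun a => ?_
    rw [ContinuousLinearMap.coe_coe, ContinuousLinearMap.fromCompletion_apply_coe,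
      UniformSpace.Completion.norm_coe]
    exact ((liouvilleIsometryAux C).isometryOfInner (inner_liouvilleIsometryAux C)).norm_map a

theorem liouvilleIsometry_coe (C : H ≃ₗᵢ⋆[ℂ] H) (φ χ : H) :
    liouvilleIsometry C ((φ ⊗ₜ[ℂ] χ : H ⊗[ℂ] H) : HilbertTensor H) = rankOne (C.symm χ) φ :=
  ContinuousLinearMap.fromCompletion_apply_coe _ _

theorem liouvilleIsometry_surjective (C : H ≃ₗᵢ⋆[ℂ] H) :
    Function.Surjective (liouvilleIsometry C) := by
  classical
  intro A
  have hcl : IsClosed (Set.range (liouvilleIsometry C)) :=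
    (liouvilleIsometry C).isometry.isClosedEmbedding.isClosed_range
  have hsum := (lp.hasSum_single (by norm_num) (LiouvilleSpace.columnsIso H A)).map
    (LiouvilleSpace.columnsIso H).symm (LiouvilleSpace.columnsIso H).symm.continuous
  rw [LinearIsometryEquiv.symm_apply_apply] at hsum
  refine hcl.mem_of_tendsto hsum (Filter.Eventually.of_forall fun s => ?_)
  refine Submodule.sum_mem (LinearMap.range (liouvilleIsometry C).toLinearMap) fun i _ => ?_
  refine ⟨((A.toCLM (chosenBasis H i) ⊗ₜ[ℂ] C (chosenBasis H i) : H ⊗[ℂ] H) : HilbertTensor H), ?_⟩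
  refine (liouvilleIsometry_coe C _ _).trans ?_
  rw [LinearIsometryEquiv.symm_apply_apply, Function.comp_apply,
    LinearIsometryEquiv.eq_symm_apply]
  refine lp.ext (funext fun j => ?_)
  change inner ℂ (chosenBasis H i) (chosenBasis H j) • A.toCLM (chosenBasis H i) = _
  rw [lp.single_apply]
  by_cases h : j = i
  · subst h
    rw [inner_self_eq_norm_sq_to_K, (chosenBasis H).orthonormal.1 j]
    simp
    rfl
  · rw [(chosenBasis H).orthonormal.2 (Ne.symm h), zero_smul, Pi.single_eq_of_ne h]

/-- The unitary operator `I_C : H ⊗̄ H → 𝓛(H)` with `I_C (φ ⊗ C ψ) = P_{ψ, φ}`. -/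
def liouvilleUnitary (C : H ≃ₗᵢ⋆[ℂ] H) : HilbertTensor H ≃ₗᵢ[ℂ] LiouvilleSpace H :=
  LinearIsometryEquiv.ofSurjective (liouvilleIsometry C) (liouvilleIsometry_surjective C)

theorem liouvilleUnitary_apply (C : H ≃ₗᵢ⋆[ℂ] H) (φ ψ : H) :
    liouvilleUnitary C ((φ ⊗ₜ[ℂ] C ψ : H ⊗[ℂ] H) : HilbertTensor H) = rankOne ψ φ :=
  (liouvilleIsometry_coe C φ (C ψ)).trans (by rw [LinearIsometryEquiv.symm_apply_apply])

/-- `U T U⁻¹` for a unitary operator `U`, with domain `U D(T)`. -/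
def unitaryConj {K K' : Type*} [NormedAddCommGroup K] [InnerProductSpace ℂ K]
    [NormedAddCommGroup K'] [InnerProductSpace ℂ K'] (U : K ≃ₗᵢ[ℂ] K') (T : K →ₗ.[ℂ] K) :
    K' →ₗ.[ℂ] K' where
  domain := T.domain.comap (U.symm.toLinearEquiv : K' →ₗ[ℂ] K)
  toFun := (U.toLinearEquiv : K →ₗ[ℂ] K') ∘ₗ T.toFun ∘ₗ
    ((U.symm.toLinearEquiv : K' →ₗ[ℂ] K).restrict fun _ hx => hx)

/-- The Liouvillian `𝓛_T = I_C L I_C⁻¹` on the Liouville space. -/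
def liouvillian (C : H ≃ₗᵢ⋆[ℂ] H) (T : H →ₗ.[ℂ] H) : LiouvilleSpace H →ₗ.[ℂ] LiouvilleSpace H :=
  unitaryConj (liouvilleUnitary C) (liouvilleTensor C T)

/-- `η ⊗ η` on `H ⊗̄ H`. -/
def etaTensor (η : H →L[ℂ] H) : HilbertTensor H →ₗ.[ℂ] HilbertTensor H :=
  (hilbertTensorMap η η).toLinearMap.toPMap ⊤

/-- `ζ = I_C (η ⊗ η) I_C⁻¹` on the Liouville space. -/
def zeta (C : H ≃ₗᵢ⋆[ℂ] H) (η : H →L[ℂ] H) : LiouvilleSpace H →ₗ.[ℂ] LiouvilleSpace H :=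
  unitaryConj (liouvilleUnitary C) (etaTensor η)

/-- `T† = η T η⁻¹` as partially defined operators (in particular `η D(T) = D(T†)`): the graph of
`η T η⁻¹` is `{(η x, η (T x)) | x ∈ D(T)}`. -/
def IsQuasiHermitian (η : H →L[ℂ] H) (T : H →ₗ.[ℂ] H) : Prop :=
  T.adjoint.graph = T.graph.map (η.toLinearMap.prodMap η.toLinearMap)

end HilbertSchmidt

section Rigged

/-- Nuclear spaces: `E` is locally convex, and for every continuous seminorm `p` the canonical map
of `E` into the completion `E_p` of `(E, p)` is nuclear, that is, of the form
`x ↦ ∑ c_n f_n(x) y_n` with `∑ |c_n| < ∞`, `(f_n)` equicontinuous in the dual and `(y_n)` bounded in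
`E_p`. The `y_n` may be taken in `E`, which is dense in `E_p`: write each as an absolutely
convergent series of elements of `E`. -/
def IsNuclear (E : Type*) [AddCommGroup E] [Module ℂ E] [TopologicalSpace E] : Prop :=
  LocallyConvexSpace ℝ E ∧
  ∀ p : Seminorm ℂ E, Continuous p → ∃ q : Seminorm ℂ E, Continuous q ∧
    ∃ (c : ℕ → ℝ) (f : ℕ → E →L[ℂ] ℂ) (y : ℕ → E), Summable c ∧ (∀ n x, ‖f n x‖ ≤ q x) ∧
      (∀ n, p (y n) ≤ 1) ∧
      ∀ x, Filter.Tendsto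
        (fun N => p (x - ∑ n ∈ Finset.range N, (c n : ℂ) • f n x • y n)) Filter.atTop (𝓝 0)

/-- `Φ ⊂ H ⊂ Φ′, Φ^×` is a rigged Hilbert space, with continuous inclusion `ι : Φ → H`. The last
condition says that the topologies of `Φ` and `H` are compatible: a Cauchy filter of `Φ` that
converges to `0` in `H` converges to `0` in `Φ`. It says that the completion of `Φ` is still
contained in `H`, and holds automatically when `Φ` is complete. -/
structure IsRiggedHilbertSpace {Φ H : Type*} [AddCommGroup Φ] [Module ℂ Φ] [UniformSpace Φ]
    [NormedAddCommGroup H] [InnerProductSpace ℂ H] (ι : Φ →L[ℂ] H) : Prop where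
  injective : Function.Injective ι
  denseRange : DenseRange ι
  nuclear : IsNuclear Φ
  compatible : ∀ F : Filter Φ, Cauchy F → Filter.Tendsto ι F (𝓝 0) → F ≤ 𝓝 0

/-- `A` maps `E` into `E` and its restriction to `E` is the continuous operator `T`; here `E` is
regarded as a subspace of `F` by `κ`. -/
def RestrictsTo {E F : Type*} [AddCommGroup E] [Module ℂ E] [TopologicalSpace E] [AddCommGroup F]
    [Module ℂ F] (κ : E →ₗ[ℂ] F) (A : F →ₗ.[ℂ] F) (T : E →L[ℂ] E) : Prop :=
  ∀ x, (κ x, κ (T x)) ∈ A.graph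

/-- `E ⊂ D(A)`, `A E ⊂ E` and `A` is continuous on `E`, so that `A` has a well-defined continuous
restriction to `E`. -/
def HasRestriction {E F : Type*} [AddCommGroup E] [Module ℂ E] [TopologicalSpace E]
    [AddCommGroup F] [Module ℂ F] (κ : E →ₗ[ℂ] F) (A : F →ₗ.[ℂ] F) : Prop :=
  ∃! T : E →L[ℂ] E, RestrictsTo κ A T

open Classical in
/-- The continuous restriction of `A` to `E` (`0` if there is none). -/
def restriction {E F : Type*} [AddCommGroup E] [Module ℂ E] [TopologicalSpace E] [AddCommGroup F]
    [Module ℂ F] (κ : E →ₗ[ℂ] F) (A : F →ₗ.[ℂ] F) : E →L[ℂ] E :=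
  if h : ∃ T : E →L[ℂ] E, RestrictsTo κ A T then h.choose else 0

/-- Operators on the dual spaces `E′ ∪ E^×` that act linearly on the dual `E′` and on the antidual
`E^×`; the product `S * T` is composition, `T` first. -/
abbrev DualOperator (E : Type*) [AddCommGroup E] [Module ℂ E] [TopologicalSpace E] : Type _ :=
  Module.End ℂ (E →L[ℂ] ℂ) × Module.End ℂ (E →L⋆[ℂ] ℂ)

/-- `T̂` on the dual spaces: `(T̂ f) x = f (T x)`. Writing `f T̂` for `T̂ f`, one has
`f (S T)^ = (f Ŝ) T̂`; as a composition of maps, `hat (S ∘ T) = hat T * hat S`. -/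
def hat {E : Type*} [AddCommGroup E] [Module ℂ E] [TopologicalSpace E] (T : E →L[ℂ] E) :
    DualOperator E :=
  ({ toFun := fun f => f.comp T
     map_add' := fun _ _ => rfl
     map_smul' := fun _ _ => rfl },
   { toFun := fun f => f.comp T
     map_add' := fun _ _ => rfl
     map_smul' := fun _ _ => rfl })

/-- The extension `Â` to `E′ ∪ E^×` of an operator `A` on `F ⊃ E`: `(Â f) x = f (A x)`. -/
def extension {E F : Type*} [AddCommGroup E] [Module ℂ E] [TopologicalSpace E] [AddCommGroup F]
    [Module ℂ F] (κ : E →ₗ[ℂ] F) (A : F →ₗ.[ℂ] F) : DualOperator E :=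
  hat (restriction κ A)

variable {Φ : Type*} [AddCommGroup Φ] [Module ℂ Φ] [TopologicalSpace Φ]

/-- `Ĉ : Φ′ → Φ^×`, `(Ĉ f) x = f (C x)`. -/
def conjHatDual (C : Φ →L⋆[ℂ] Φ) : (Φ →L[ℂ] ℂ) →ₗ[ℂ] (Φ →L⋆[ℂ] ℂ) where
  toFun f := f.comp C
  map_add' _ _ := rfl
  map_smul' _ _ := rfl

/-- `Ĉ : Φ^× → Φ′`, `(Ĉ f) x = f (C x)`. -/
def conjHatAntidual (C : Φ →L⋆[ℂ] Φ) : (Φ →L⋆[ℂ] ℂ) →ₗ[ℂ] (Φ →L[ℂ] ℂ) where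
  toFun f := f.comp C
  map_add' _ _ := rfl
  map_smul' _ _ := rfl

/-- `Ĉ S Ĉ` on `Φ′ ∪ Φ^×`. -/
def conjHat (C : Φ →L⋆[ℂ] Φ) (S : DualOperator Φ) : DualOperator Φ :=
  (conjHatAntidual C ∘ₗ S.2 ∘ₗ conjHatDual C, conjHatDual C ∘ₗ S.1 ∘ₗ conjHatAntidual C)

/-- The extension of `Â₁ ⊗ B̂₁ - Â₂ ⊗ B̂₂` to `(Φ ⊗̂ Φ)′ ∪ (Φ ⊗̂ Φ)^×`:
`f ↦ (x ↦ f ((A₁ ⊗ B₁ - A₂ ⊗ B₂) x))`. -/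
def tensorExtension [ContinuousSMul ℂ Φ] (A₁ B₁ A₂ B₂ : Φ →L[ℂ] Φ) :
    DualOperator (CompletedTensor Φ) :=
  hat (tensorMap A₁ B₁ - tensorMap A₂ B₂)

variable {H : Type*} [NormedAddCommGroup H] [InnerProductSpace ℂ H] [CompleteSpace H]

/-- `Φ_𝓛 = I_C (Φ ⊗̂ Φ)`, a subspace of the Liouville space. -/
def RiggedLiouvilleSpace [ContinuousSMul ℂ Φ] (C : H ≃ₗᵢ⋆[ℂ] H) (ι : Φ →L[ℂ] H) : Type _ :=
  LinearMap.range ((liouvilleUnitary C).toLinearEquiv.toLinearMap ∘ₗ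
    (tensorEmbedding ι).toLinearMap)

namespace RiggedLiouvilleSpace

variable [ContinuousSMul ℂ Φ] (C : H ≃ₗᵢ⋆[ℂ] H) (ι : Φ →L[ℂ] H)

instance : AddCommGroup (RiggedLiouvilleSpace C ι) :=
  inferInstanceAs (AddCommGroup (LinearMap.range _))

instance : Module ℂ (RiggedLiouvilleSpace C ι) :=
  inferInstanceAs (Module ℂ (LinearMap.range _))

/-- `I_C : Φ ⊗̂ Φ → Φ_𝓛`. -/
def ofTensor : CompletedTensor Φ →ₗ[ℂ] RiggedLiouvilleSpace C ι :=
  LinearMap.rangeRestrict _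

/-- The inclusion `Φ_𝓛 ⊂ 𝓛(H)`. -/
def incl : RiggedLiouvilleSpace C ι →ₗ[ℂ] LiouvilleSpace H := Submodule.subtype _

/-- The topology transported by `I_C`: `W ⊂ Φ_𝓛` is open if and only if `I_C⁻¹ W` is open. -/
instance : TopologicalSpace (RiggedLiouvilleSpace C ι) :=
  TopologicalSpace.coinduced (ofTensor C ι) inferInstance

end RiggedLiouvilleSpace

end Rigged

end RiggedLiouville

end

noncomputable section

namespace RiggedLiouville

/-! ### Convex circled hulls of elementary tensors. -/

section Algebra

variable {Φ : Type*} [AddCommGroup Φ] [Module ℂ Φ]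

/-! Everything reduces to operators on `Φ ⊗̂ Φ` determined by their values on elementary tensors. On
`Φ`, quasi-Hermiticity makes `T†` restrict to `S = η T η⁻¹`. With `K(A) = A ⊗ I - I ⊗ C A C`
(`tensorCommutator`), `L` restricts to `K(T)` and `L†` to `K(S)`. Both follow by checking elementary
tensors and passing to limits, since the graph of a closure and an adjoint relation are closed
(`mem_of_tmul_mem`). The pairs given by `K(S)` also make the adjoint relation densely defined, so
the operator that defines `L` is closable. As `η` commutes with `C`, `K(S) (η ⊗ η) = (η ⊗ η) K(T)`.
Pullback to functionals reverses this product and gives relation 2 (`exists_unit_hat_conj`);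
transport by `I_C` gives relation 3.

The analytic point is that `Φ ⊗̂ Φ → H ⊗̄ H` is injective
(`IsRiggedHilbertSpace.tensorEmbedding_injective`). If `z` is mapped to `0`, then `⟪w, ·⟫ ⊗ ⟪v, ·⟫`
kills `z` for all `w`, `v` in `H`. Slicing one factor turns a Cauchy filter converging to `z` into a
Cauchy filter of `Φ`; compatibility of the topologies upgrades its weak convergence to `0` in `H` to
convergence in `Φ`. Doing this in each factor shows that `f ⊗ g` kills `z` for all `f`, `g` in `Φ′`.
Nuclearity then approximates the identity of `Φ` by equicontinuous finite-rank maps `A_N`. Since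
`A_N ⊗ A_N` is built from finitely many functionals `f ⊗ g`, it sends the filter to `0`, and so the
filter itself tends to `0` (`Cauchy.le_nhds_zero_of_isNuclear`). -/

theorem ProjTensor.induction_on {motive : ProjTensor Φ → Prop} (x : ProjTensor Φ)
    (zero : motive 0) (tmul : ∀ a b, motive (ProjTensor.tmul a b))
    (add : ∀ x y, motive x → motive y → motive (x + y)) : motive x :=
  TensorProduct.induction_on x zero tmul add

theorem ProjTensor.add_tmul (a a' b : Φ) :
    ProjTensor.tmul (a + a') b = ProjTensor.tmul a b + ProjTensor.tmul a' b :=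
  TensorProduct.add_tmul _ _ _

theorem ProjTensor.tmul_add (a b b' : Φ) :
    ProjTensor.tmul a (b + b') = ProjTensor.tmul a b + ProjTensor.tmul a b' :=
  TensorProduct.tmul_add _ _ _

theorem ProjTensor.smul_tmul_smul (c d : ℂ) (a b : Φ) :
    ProjTensor.tmul (c • a) (d • b) = (c * d) • ProjTensor.tmul a b :=
  TensorProduct.smul_tmul_smul _ _ _ _

/-- Only the product of the two seminorms matters: `c • a ⊗ b = (r c a) ⊗ (r⁻¹ b)`, and a suitable
`r` puts both factors into the unit ball. -/
theorem smul_tmul_mem_tensorHull_ball {p : Seminorm ℂ Φ} {a b : Φ} {c : ℂ}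
    (h : ‖c‖ * p a * p b < 1) : c • ProjTensor.tmul a b ∈ tensorHull (p.ball 0 1) := by
  -- Any `r` strictly between `p b` and `1 / (‖c‖ p a)` will do; if `‖c‖ p a = 0` there is no upper
  -- bound, and `p b + 1` serves.
  obtain ⟨r, hr, hra, hrb⟩ : ∃ r : ℝ, 0 < r ∧ r * (‖c‖ * p a) < 1 ∧ p b < r := by
    rcases (mul_nonneg (norm_nonneg c) (apply_nonneg p a)).eq_or_lt with h0 | h0
    · exact ⟨p b + 1, by positivity, by rw [← h0]; norm_num, by linarith⟩
    · obtain ⟨r, h1, h2⟩ := exists_between ((lt_div_iff₀' h0).mpr h)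
      exact ⟨r, (apply_nonneg p b).trans_lt h1, (lt_div_iff₀ h0).mp h2, h1⟩
  have hr' : (r : ℂ) ≠ 0 := by exact_mod_cast hr.ne'
  have e : c • ProjTensor.tmul a b = ProjTensor.tmul ((r * c : ℂ) • a) ((r : ℂ)⁻¹ • b) := by
    rw [ProjTensor.smul_tmul_smul]
    congr 1
    field_simp
  rw [e]
  apply tmul_mem_tensorHull
  · rw [Seminorm.mem_ball_zero, map_smul_eq_mul, norm_mul, Complex.norm_real, Real.norm_eq_abs,
      abs_of_pos hr, mul_assoc]
    exact hra
  · rw [Seminorm.mem_ball_zero, map_smul_eq_mul, norm_inv, Complex.norm_real, Real.norm_eq_abs,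
      abs_of_pos hr, inv_mul_lt_iff₀ hr, mul_one]
    exact hrb

theorem smul_add_mem_tensorHull {V : Set Φ} {x y : ProjTensor Φ} {c : ℂ}
    (hx : (2 * c) • x ∈ tensorHull V) (hy : (2 * c) • y ∈ tensorHull V) :
    c • (x + y) ∈ tensorHull V := by
  have := convex_tensorHull V hx hy (by norm_num : (0 : ℝ) ≤ 1 / 2)
    (by norm_num : (0 : ℝ) ≤ 1 / 2) (by norm_num)
  have e : ∀ z : ProjTensor Φ, (1 / 2 : ℝ) • (2 * c) • z = c • z := by
    intro z
    rw [← Complex.coe_smul, smul_smul, ← mul_assoc]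
    norm_num
  rwa [e, e, ← smul_add] at this

/-- `A ⊗ A` on `Φ ⊗ Φ`. -/
def tensorSquare (A : Φ →ₗ[ℂ] Φ) : ProjTensor Φ →ₗ[ℂ] ProjTensor Φ :=
  (TensorProduct.map A A : Φ ⊗[ℂ] Φ →ₗ[ℂ] Φ ⊗[ℂ] Φ)

theorem tensorSquare_tmul (A : Φ →ₗ[ℂ] Φ) (a b : Φ) :
    tensorSquare A (ProjTensor.tmul a b) = ProjTensor.tmul (A a) (A b) := rfl

/-- The preimage of a convex circled set under a linear map is convex and circled. Continuity of `A`
plays no role, so one `W` can serve a whole family of maps: this is how equicontinuity passes to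
tensor squares. -/
theorem tensorSquare_mapsTo {A : Φ →ₗ[ℂ] Φ} {V W : Set Φ} (h : ∀ a ∈ W, A a ∈ V) :
    ∀ x ∈ tensorHull W, tensorSquare A x ∈ tensorHull V := by
  apply tensorHull_subset (S := {x | tensorSquare A x ∈ tensorHull V})
  · intro x hx y hy s t hs ht hst
    have hreal : ∀ (s : ℝ) x, tensorSquare A (s • x) = s • tensorSquare A x := fun s x => by
      rw [← Complex.coe_smul, map_smul, Complex.coe_smul]
    simpa [hreal] using convex_tensorHull V hx hy hs ht hst
  · rintro k hk _ ⟨x, hx, rfl⟩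
    simpa using balanced_tensorHull V k hk (Set.smul_mem_smul_set hx)
  · exact fun a ha b hb => tmul_mem_tensorHull (h a ha) (h b hb)

end Algebra

/-! ### Cauchy filters and approximations of the identity. -/

section Approximation

open Filter

/-- A Cauchy filter that is mapped to `0` by additive maps which approximate the identity pointwise
and equicontinuously converges to `0`. -/
theorem cauchy_le_nhds_zero_of_approx {E : Type*} [AddCommGroup E] [UniformSpace E]
    [IsUniformAddGroup E] {F : Filter E} (hF : Cauchy F)
    (h : ∀ U ∈ 𝓝 (0 : E), ∃ P : ℕ → E →+ E, (∃ W ∈ 𝓝 (0 : E), ∀ N, ∀ x ∈ W, P N x ∈ U) ∧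
      (∀ x, ∃ N, x - P N x ∈ U) ∧ ∀ N, Tendsto (P N) F (𝓝 0)) : F ≤ 𝓝 0 := by
  intro U₀ hU₀
  obtain ⟨U₁, hU₁, hU₁'⟩ := exists_nhds_zero_half hU₀
  obtain ⟨U, hU, hU'⟩ := exists_nhds_zero_half hU₁
  obtain ⟨P, ⟨W, hW, hPW⟩, happ, hlim⟩ := h U hU
  -- Order of choices: a small set `S` of the filter, then `x₀` in `S`, then `N` for this single
  -- point `x₀`; only afterwards does `x` run through the filter. Equicontinuity controls `P N (x₀ -
  -- x)` although `N` is chosen after `S`.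
  have hd : Tendsto (fun q : E × E => q.1 - q.2) (F ×ˢ F) (𝓝 0) := by
    have := hF.2
    rw [uniformity_eq_comap_nhds_zero_swapped] at this
    exact tendsto_iff_comap.mpr this
  have hS := (hd (inter_mem (inter_mem hU hW) (inter_mem hU (neg_mem_nhds_zero E hW))))
  obtain ⟨S, hS, hSS⟩ := mem_prod_same_iff.mp hS
  have := hF.1
  obtain ⟨x₀, hx₀⟩ := nonempty_of_mem hS
  obtain ⟨N, hN⟩ := happ x₀
  filter_upwards [hS, hlim N hU] with x hx hPx
  have h1 := hSS (Set.mk_mem_prod hx hx₀)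
  have h2 : P N (x₀ - x) ∈ U := hPW N _ (by simpa using h1.2.2)
  have e : x = ((x - x₀) + (x₀ - P N x₀)) + (P N (x₀ - x) + P N x) := by
    rw [map_sub]; abel
  rw [e]
  exact hU₁' _ (hU' _ h1.1.1 _ hN) _ (hU' _ h2 _ hPx)

end Approximation

/-! ### Nuclearity: product functionals detect convergence to zero of Cauchy filters. -/

section Nuclear

open Filter

variable {Φ : Type*} [AddCommGroup Φ] [Module ℂ Φ]

/-- On elementary tensors, `a ⊗ b - A a ⊗ A b = (a - A a) ⊗ A b + a ⊗ (b - A b)`, where `p (A b)`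
stays bounded. The scalar `c` is quantified inside the induction because each sum costs a factor
`2`. -/
theorem tendsto_sub_tensorSquare {p : Seminorm ℂ Φ} {A : ℕ → Φ →ₗ[ℂ] Φ}
    (hA : ∀ a, Tendsto (fun N => p (a - A N a)) atTop (𝓝 0)) (x : ProjTensor Φ) :
    ∀ c : ℂ, ∀ᶠ N in atTop, c • (x - tensorSquare (A N) x) ∈ tensorHull (p.ball 0 1) := by
  induction x using ProjTensor.induction_on with
  | zero =>
    intro c
    refine Eventually.of_forall fun N => ?_
    have := smul_tmul_mem_tensorHull_ball (p := p) (a := 0) (b := 0) (c := 0) (by simp)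
    simpa using this
  | tmul a b =>
    intro c
    have hb : ∀ᶠ N in atTop, p (A N b) ≤ p b + 1 := by
      filter_upwards [(hA b).eventually (gt_mem_nhds one_pos)] with N hN
      have := map_sub_le_add p b (b - A N b)
      rw [sub_sub_cancel] at this
      linarith
    have h1 : ∀ᶠ N in atTop, ‖2 * c‖ * p (a - A N a) * (p b + 1) < 1 := by
      have := ((hA a).const_mul ‖2 * c‖).mul_const (p b + 1)
      rw [mul_zero, zero_mul] at this
      exact this.eventually (gt_mem_nhds one_pos)
    have h2 : ∀ᶠ N in atTop, ‖2 * c‖ * p a * p (b - A N b) < 1 := by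
      have := (hA b).const_mul (‖2 * c‖ * p a)
      rw [mul_zero] at this
      exact this.eventually (gt_mem_nhds one_pos)
    filter_upwards [hb, h1, h2] with N hb h1 h2
    have e : ProjTensor.tmul a b - tensorSquare (A N) (ProjTensor.tmul a b) =
        ProjTensor.tmul (a - A N a) (A N b) + ProjTensor.tmul a (b - A N b) := by
      rw [tensorSquare_tmul, sub_eq_iff_eq_add, add_right_comm, ← ProjTensor.add_tmul,
        sub_add_cancel, ← ProjTensor.tmul_add, add_sub_cancel]
    rw [e]
    refine smul_add_mem_tensorHull (smul_tmul_mem_tensorHull_ball (lt_of_le_of_lt ?_ h1))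
      (smul_tmul_mem_tensorHull_ball h2)
    gcongr
  | add x y hx hy =>
    intro c
    filter_upwards [hx (2 * c), hy (2 * c)] with N h1 h2
    rw [map_add, add_sub_add_comm]
    exact smul_add_mem_tensorHull h1 h2

variable [TopologicalSpace Φ] [ContinuousSMul ℂ Φ]

theorem tensorFunctional_coe_tmul {σ : ℂ →+* ℂ} [RingHomIsometric σ] (f g : Φ →SL[σ] ℂ) (a b : Φ) :
    tensorFunctional f g (ProjTensor.tmul a b : ProjTensor Φ) = f a * g b :=
  ContinuousLinearMap.fromCompletion_apply_coe _ _

theorem tensorMap_coe_tmul (A B : Φ →L[ℂ] Φ) (a b : Φ) :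
    tensorMap A B (ProjTensor.tmul a b : ProjTensor Φ) =
      (ProjTensor.tmul (A a) (B b) : ProjTensor Φ) :=
  ContinuousLinearMap.completion_apply_coe _ _

/-- The tensor square of a finite-rank map sees its argument only through finitely many product
functionals. -/
theorem tensorSquare_sum_smulRight (s : Finset ℕ) (c : ℕ → ℂ) (f : ℕ → Φ →L[ℂ] ℂ) (y : ℕ → Φ)
    (x : ProjTensor Φ) :
    tensorSquare (∑ n ∈ s, c n • (f n : Φ →ₗ[ℂ] ℂ).smulRight (y n)) x =
      ∑ n ∈ s, ∑ m ∈ s, (c n * c m * tensorFunctional (f n) (f m) (x : CompletedTensor Φ)) •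
        ProjTensor.tmul (y n) (y m) := by
  induction x using ProjTensor.induction_on with
  | zero => simp [UniformSpace.Completion.coe_zero]
  | add x y hx hy =>
    simp only [map_add, UniformSpace.Completion.coe_add, mul_add, add_smul, Finset.sum_add_distrib,
      hx, hy]
  | tmul a b =>
    rw [tensorSquare_tmul]
    simp only [LinearMap.sum_apply, LinearMap.smul_apply, LinearMap.smulRight_apply, smul_smul]
    refine (TensorProduct.sum_tmul _ _ _).trans (Finset.sum_congr rfl fun n _ => ?_)
    refine (TensorProduct.tmul_sum _ _ _).trans (Finset.sum_congr rfl fun m _ => ?_)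
    rw [tensorFunctional_coe_tmul]
    refine (ProjTensor.smul_tmul_smul _ _ _ _).trans ?_
    congr 1
    change c n * f n a * (c m * f m b) = c n * c m * (f n a * f m b)
    ring

/-- The partial sums of the nuclear expansion of the identity, tensored with themselves, are the
approximating maps required by `cauchy_le_nhds_zero_of_approx`. -/
theorem Cauchy.le_nhds_zero_of_isNuclear [IsTopologicalAddGroup Φ] (hΦ : IsNuclear Φ)
    {F : Filter (ProjTensor Φ)} (hF : Cauchy F)
    (h : ∀ f g : Φ →L[ℂ] ℂ,
      Tendsto (fun x : ProjTensor Φ => tensorFunctional f g (x : CompletedTensor Φ)) F (𝓝 0)) :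
    F ≤ 𝓝 0 := by
  refine cauchy_le_nhds_zero_of_approx hF fun U hU => ?_
  obtain ⟨V, hV, hVU⟩ := projTensor_hasBasis.mem_iff.mp hU
  have := hΦ.1
  -- `p` is the gauge of a convex circled neighbourhood contained in `V`.
  obtain ⟨p, hp, hpV⟩ : ∃ p : Seminorm ℂ Φ, Continuous p ∧ p.ball 0 1 ⊆ V := by
    have : ContinuousSMul ℝ Φ := IsScalarTower.continuousSMul ℂ
    obtain ⟨U', ⟨hU', hUc⟩, hU'V⟩ :=
      (LocallyConvexSpace.convex_basis_zero ℝ Φ).mem_iff.mp hV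
    have hK := balanced_convexHull_real (balancedCore_balanced (𝕜 := ℂ) U')
    have hK0 : convexHull ℝ (balancedCore ℂ U') ∈ 𝓝 0 :=
      Filter.mem_of_superset (balancedCore_mem_nhds_zero hU') (subset_convexHull ℝ _)
    refine ⟨gaugeSeminorm hK (convex_convexHull ℝ _) (absorbent_nhds_zero hK0),
      continuous_gauge (convex_convexHull ℝ _) hK0, fun x hx => ?_⟩
    rw [Seminorm.mem_ball_zero] at hx
    exact hU'V (convexHull_min (balancedCore_subset U') hUc
      (setOfPred_gauge_lt_one_subset_self (convex_convexHull ℝ _) (mem_of_mem_nhds hK0)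
        (absorbent_nhds_zero hK0) hx))
  obtain ⟨q, hq, c, f, y, hc, hf, hy, hlim⟩ := hΦ.2 p hp
  let A : ℕ → Φ →ₗ[ℂ] Φ := fun N =>
    ∑ n ∈ Finset.range N, (c n : ℂ) • (f n : Φ →ₗ[ℂ] ℂ).smulRight (y n)
  have hAx : ∀ N x, A N x = ∑ n ∈ Finset.range N, (c n : ℂ) • f n x • y n := fun N x => by
    simp [A]
  have hAb : ∀ N x, p (A N x) ≤ (∑' n, |c n|) * q x := by
    intro N x
    rw [hAx]
    calc p (∑ n ∈ Finset.range N, (c n : ℂ) • f n x • y n)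
        ≤ ∑ n ∈ Finset.range N, p ((c n : ℂ) • f n x • y n) :=
          Finset.le_sum_of_subadditive p (map_zero p).le (map_add_le_add p) _ _
      _ ≤ ∑ n ∈ Finset.range N, |c n| * q x := by
          refine Finset.sum_le_sum fun n _ => ?_
          rw [map_smul_eq_mul, map_smul_eq_mul, Complex.norm_real, Real.norm_eq_abs]
          exact mul_le_mul_of_nonneg_left ((mul_le_of_le_one_right (norm_nonneg _) (hy n)).trans
            (hf n x)) (abs_nonneg _)
      _ ≤ (∑' n, |c n|) * q x := by
          rw [← Finset.sum_mul]
          exact mul_le_mul_of_nonneg_right (hc.abs.sum_le_tsum _ fun _ _ => abs_nonneg _)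
            (apply_nonneg q x)
  refine ⟨fun N => (tensorSquare (A N)).toAddMonoidHom, ?_, fun x => ?_, fun N => ?_⟩
  -- The bound `hAb` does not depend on `N`, so this neighbourhood works for every `A N`.
  · refine ⟨tensorHull {x | (∑' n, |c n|) * q x < 1}, projTensor_hasBasis.mem_of_mem ?_, ?_⟩
    · have : Continuous fun x => (∑' n, |c n|) * q x := continuous_const.mul hq
      exact (isOpen_lt this continuous_const).mem_nhds (by simp)
    · intro N x hx
      refine hVU (tensorHull_mono hpV (tensorSquare_mapsTo (fun a ha => ?_) x hx))
      rw [Seminorm.mem_ball_zero]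
      exact (hAb N a).trans_lt ha
  · have := tendsto_sub_tensorSquare (p := p) (A := A) (by simpa only [hAx] using hlim) x 1
    obtain ⟨N, hN⟩ := this.exists
    refine ⟨N, hVU (tensorHull_mono hpV ?_)⟩
    simpa using hN
  · change Tendsto (fun x => tensorSquare (A N) x) F (𝓝 0)
    simp only [A, tensorSquare_sum_smulRight]
    rw [← Finset.sum_const_zero (s := Finset.range N)]
    refine tendsto_finsetSum _ fun n _ => ?_
    rw [← Finset.sum_const_zero (s := Finset.range N)]
    refine tendsto_finsetSum _ fun m _ => ?_
    have := ((h (f n) (f m)).const_mul (c n * c m : ℂ)).smul_const (ProjTensor.tmul (y n) (y m))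
    simpa using this

end Nuclear

/-! ### Injectivity of `Φ ⊗̂ Φ → H ⊗̄ H`. -/

section Injective

open Filter

variable {Φ : Type*} [AddCommGroup Φ] [Module ℂ Φ] [UniformSpace Φ] [IsUniformAddGroup Φ]
  [ContinuousSMul ℂ Φ]

/-- `f ⊗ I : Φ ⊗ Φ → Φ`. -/
def sliceLeft [LocallyConvexSpace ℝ Φ] (f : Φ →L[ℂ] ℂ) : ProjTensor Φ →L[ℂ] Φ where
  toLinearMap := (TensorProduct.lift (LinearMap.lsmul ℂ Φ ∘ₗ (f : Φ →ₗ[ℂ] ℂ)) :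
    ProjTensor Φ →ₗ[ℂ] Φ)
  cont := by
    refine continuous_of_tmul _ fun U hU => ?_
    have h : Tendsto (fun p : Φ × Φ => f p.1 • p.2) (𝓝 (0, 0)) (𝓝 0) := by
      have hc : Continuous fun p : Φ × Φ => f p.1 • p.2 := by fun_prop
      simpa using hc.tendsto (0, 0)
    obtain ⟨V, hV, W, hW, hVW⟩ := mem_nhds_prod_iff.mp (h hU)
    refine ⟨V ∩ W, Filter.inter_mem hV hW, ?_⟩
    rintro a ⟨ha, -⟩ b ⟨-, hb⟩
    exact hVW (Set.mk_mem_prod ha hb)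

/-- `I ⊗ g : Φ ⊗ Φ → Φ`. -/
def sliceRight [LocallyConvexSpace ℝ Φ] (g : Φ →L[ℂ] ℂ) : ProjTensor Φ →L[ℂ] Φ where
  toLinearMap := (TensorProduct.lift (LinearMap.lsmul ℂ Φ ∘ₗ (g : Φ →ₗ[ℂ] ℂ)).flip :
    ProjTensor Φ →ₗ[ℂ] Φ)
  cont := by
    refine continuous_of_tmul _ fun U hU => ?_
    have h : Tendsto (fun p : Φ × Φ => g p.2 • p.1) (𝓝 (0, 0)) (𝓝 0) := by
      have hc : Continuous fun p : Φ × Φ => g p.2 • p.1 := by fun_prop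
      simpa using hc.tendsto (0, 0)
    obtain ⟨V, hV, W, hW, hVW⟩ := mem_nhds_prod_iff.mp (h hU)
    refine ⟨V ∩ W, Filter.inter_mem hV hW, ?_⟩
    rintro a ⟨ha, -⟩ b ⟨-, hb⟩
    exact hVW (Set.mk_mem_prod ha hb)

theorem apply_sliceLeft [LocallyConvexSpace ℝ Φ] (f g : Φ →L[ℂ] ℂ) (x : ProjTensor Φ) :
    g (sliceLeft f x) = tensorFunctional f g (x : CompletedTensor Φ) := by
  induction x using ProjTensor.induction_on with
  | zero => simp [UniformSpace.Completion.coe_zero]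
  | add x y hx hy => simp only [map_add, UniformSpace.Completion.coe_add, hx, hy]
  | tmul a b =>
    rw [tensorFunctional_coe_tmul]
    change g (f a • b) = _
    rw [map_smul, smul_eq_mul]

theorem apply_sliceRight [LocallyConvexSpace ℝ Φ] (f g : Φ →L[ℂ] ℂ) (x : ProjTensor Φ) :
    f (sliceRight g x) = tensorFunctional f g (x : CompletedTensor Φ) := by
  induction x using ProjTensor.induction_on with
  | zero => simp [UniformSpace.Completion.coe_zero]
  | add x y hx hy => simp only [map_add, UniformSpace.Completion.coe_add, hx, hy]
  | tmul a b =>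
    rw [tensorFunctional_coe_tmul]
    change f (g b • a) = _
    rw [map_smul, smul_eq_mul, mul_comm]

variable {H : Type*} [NormedAddCommGroup H] [InnerProductSpace ℂ H]

omit [IsUniformAddGroup Φ] in
theorem tensorEmbedding_coe_tmul (ι : Φ →L[ℂ] H) (a b : Φ) :
    tensorEmbedding ι (ProjTensor.tmul a b : ProjTensor Φ) =
      ((ι a ⊗ₜ[ℂ] ι b : H ⊗[ℂ] H) : HilbertTensor H) :=
  ContinuousLinearMap.completion_apply_coe _ _

omit [IsUniformAddGroup Φ] in
/-- Continuous linear maps on `Φ ⊗̂ Φ` that agree on elementary tensors are equal. -/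
theorem CompletedTensor.ext {σ : ℂ →+* ℂ} {G : Type*} [AddCommGroup G] [Module ℂ G]
    [TopologicalSpace G] [T2Space G] {u v : CompletedTensor Φ →SL[σ] G}
    (h : ∀ a b, u (ProjTensor.tmul a b : ProjTensor Φ) = v (ProjTensor.tmul a b : ProjTensor Φ)) :
    u = v := by
  ext z
  induction z using UniformSpace.Completion.induction_on with
  | hp => exact isClosed_eq u.continuous v.continuous
  | ih x =>
    induction x using ProjTensor.induction_on with
    | zero => simp [UniformSpace.Completion.coe_zero]
    | add x y hx hy => simp only [map_add, UniformSpace.Completion.coe_add, hx, hy]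
    | tmul a b => exact h a b

omit [IsUniformAddGroup Φ] in
-- Translates the vanishing of the image of `z` in `H ⊗̄ H` into the vanishing on `z` of product
-- functionals that come from `H`.
theorem inner_tensorEmbedding (ι : Φ →L[ℂ] H) (h h' : H) (z : CompletedTensor Φ) :
    inner ℂ ((h ⊗ₜ[ℂ] h' : H ⊗[ℂ] H) : HilbertTensor H) (tensorEmbedding ι z) =
      tensorFunctional ((innerSL ℂ h).comp ι) ((innerSL ℂ h').comp ι) z := by
  suffices (innerSL ℂ ((h ⊗ₜ[ℂ] h' : H ⊗[ℂ] H) : HilbertTensor H)).comp (tensorEmbedding ι) =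
      tensorFunctional ((innerSL ℂ h).comp ι) ((innerSL ℂ h').comp ι) from
    DFunLike.congr_fun this z
  refine CompletedTensor.ext fun a b => ?_
  rw [tensorFunctional_coe_tmul, ContinuousLinearMap.comp_apply, tensorEmbedding_coe_tmul,
    innerSL_apply_apply, UniformSpace.Completion.inner_coe, TensorProduct.inner_tmul]
  rfl

variable [CompleteSpace H] {ι : Φ →L[ℂ] H}

omit [ContinuousSMul ℂ Φ] in
-- The filter is also Cauchy in the complete space `H`. Its norm limit there is its weak limit,
-- hence `0`, and compatibility lifts this to `Φ`.
theorem IsRiggedHilbertSpace.le_nhds_zero (hι : IsRiggedHilbertSpace ι) {F : Filter Φ}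
    (hF : Cauchy F) (h : ∀ v, Tendsto (fun x => inner ℂ v (ι x)) F (𝓝 0)) : F ≤ 𝓝 0 := by
  refine hι.compatible F hF ?_
  obtain ⟨y, hy⟩ := CompleteSpace.complete (hF.map ι.uniformContinuous)
  have := hF.1
  have hy0 : y = 0 := by
    refine ext_inner_left ℂ fun v => ?_
    rw [inner_zero_right]
    exact tendsto_nhds_unique
      ((tendsto_const_nhds (x := v)).inner (show Tendsto ι F (𝓝 y) from hy)) (h v)
  rwa [← hy0]

theorem IsRiggedHilbertSpace.tensorEmbedding_injective (hι : IsRiggedHilbertSpace ι) :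
    Function.Injective (tensorEmbedding ι) := by
  have := hι.nuclear.1
  rw [injective_iff_map_eq_zero]
  intro z hz
  -- The trace of the neighbourhoods of `z` on `Φ ⊗ Φ` replaces `z` by a Cauchy filter of algebraic
  -- tensors.
  let F : Filter (ProjTensor Φ) := comap ((↑) : ProjTensor Φ → CompletedTensor Φ) (𝓝 z)
  have hne : F.NeBot := UniformSpace.Completion.isDenseInducing_coe.comap_nhds_neBot z
  have hF : Cauchy F := cauchy_nhds.comap'
    (UniformSpace.Completion.isUniformInducing_coe _).comap_uniformity.le hne
  have hFz : Tendsto ((↑) : ProjTensor Φ → CompletedTensor Φ) F (𝓝 z) := tendsto_comap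
  have htend : ∀ f g : Φ →L[ℂ] ℂ, Tendsto (fun x : ProjTensor Φ =>
      tensorFunctional f g (x : CompletedTensor Φ)) F (𝓝 (tensorFunctional f g z)) := fun f g =>
    ((tensorFunctional f g).continuous.tendsto z).comp hFz
  -- Slicing the second factor by `⟪v, ·⟫` frees the first factor: from functionals of `H` to all of
  -- `Φ′`.
  have h1 : ∀ v (f : Φ →L[ℂ] ℂ), tensorFunctional f ((innerSL ℂ v).comp ι) z = 0 := by
    intro v f
    have := hι.le_nhds_zero (hF.map (sliceRight ((innerSL ℂ v).comp ι)).uniformContinuous)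
      fun w => ?_
    · refine tendsto_nhds_unique (htend _ _) ?_
      simp only [← apply_sliceRight]
      exact (map_zero f ▸ f.continuous.tendsto 0).comp this
    · have := htend ((innerSL ℂ w).comp ι) ((innerSL ℂ v).comp ι)
      rw [← inner_tensorEmbedding, hz, inner_zero_right] at this
      simp only [← apply_sliceRight] at this
      exact tendsto_map'_iff.mpr this
  -- The same for the second factor, with slices by an arbitrary `f` in the first; `h1` supplies the
  -- weak limit `0`.
  have h2 : ∀ f g : Φ →L[ℂ] ℂ, tensorFunctional f g z = 0 := by
    intro f g
    have := hι.le_nhds_zero (hF.map (sliceLeft f).uniformContinuous) fun w => ?_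
    · refine tendsto_nhds_unique (htend _ _) ?_
      simp only [← apply_sliceLeft]
      exact (map_zero g ▸ g.continuous.tendsto 0).comp this
    · have := htend f ((innerSL ℂ w).comp ι)
      rw [h1] at this
      simp only [← apply_sliceLeft] at this
      exact tendsto_map'_iff.mpr this
  have h3 := Cauchy.le_nhds_zero_of_isNuclear hι.nuclear hF fun f g => h2 f g ▸ htend f g
  refine tendsto_nhds_unique hFz ?_
  rw [← UniformSpace.Completion.coe_zero]
  exact ((UniformSpace.Completion.continuous_coe _).tendsto 0).comp h3

end Injective

/-! ### Restrictions of partial operators and their pullbacks to the duals. -/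

section Restriction

variable {E F : Type*} [AddCommGroup E] [Module ℂ E] [TopologicalSpace E] [AddCommGroup F]
  [Module ℂ F] {κ : E →ₗ[ℂ] F} {A : F →ₗ.[ℂ] F} {S : E →L[ℂ] E}

theorem RestrictsTo.eq (hκ : Function.Injective κ) (h : RestrictsTo κ A S) {S' : E →L[ℂ] E}
    (h' : RestrictsTo κ A S') : S' = S :=
  ContinuousLinearMap.ext fun x => hκ (A.mem_graph_snd_inj (h' x) (h x) rfl)

theorem RestrictsTo.hasRestriction (hκ : Function.Injective κ) (h : RestrictsTo κ A S) :
    HasRestriction κ A :=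
  ⟨S, h, fun _ h' => h.eq hκ h'⟩

theorem RestrictsTo.restriction_eq (hκ : Function.Injective κ) (h : RestrictsTo κ A S) :
    restriction κ A = S := by
  have hex : ∃ S : E →L[ℂ] E, RestrictsTo κ A S := ⟨S, h⟩
  rw [restriction, dif_pos hex]
  exact h.eq hκ hex.choose_spec

theorem RestrictsTo.extension_eq (hκ : Function.Injective κ) (h : RestrictsTo κ A S) :
    extension κ A = hat S := by
  rw [extension, h.restriction_eq hκ]

/-- Pullback reverses composition: `B ∘ e = e ∘ A` becomes `hat e * hat B = hat A * hat e`, and `hat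
e.symm` inverts `hat e`. This reversal puts the inverse on the left. -/
theorem exists_unit_hat_conj (e : E ≃L[ℂ] E) (A B : E →L[ℂ] E)
    (h : B.comp (e : E →L[ℂ] E) = (e : E →L[ℂ] E).comp A) :
    ∃ u : (DualOperator E)ˣ, (u : DualOperator E) = hat (e : E →L[ℂ] E) ∧
      hat B = ↑u⁻¹ * hat A * ↑u := by
  have h1 : hat (e : E →L[ℂ] E) * hat (e.symm : E →L[ℂ] E) = 1 := by
    change hat ((e.symm : E →L[ℂ] E).comp (e : E →L[ℂ] E)) = 1
    rw [e.coe_symm_comp_coe]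
    rfl
  have h2 : hat (e.symm : E →L[ℂ] E) * hat (e : E →L[ℂ] E) = 1 := by
    change hat ((e : E →L[ℂ] E).comp (e.symm : E →L[ℂ] E)) = 1
    rw [e.coe_comp_coe_symm]
    rfl
  refine ⟨⟨_, _, h1, h2⟩, rfl, ?_⟩
  change hat B = hat (e.symm : E →L[ℂ] E) * hat A * hat (e : E →L[ℂ] E)
  have h3 : hat (e : E →L[ℂ] E) * hat B = hat A * hat (e : E →L[ℂ] E) := congrArg hat h
  rw [mul_assoc, ← h3, ← mul_assoc, h2, one_mul]

end Restriction

/-! ### Operator calculus on `Φ ⊗̂ Φ`. -/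

section TensorMap

variable {Φ : Type*} [AddCommGroup Φ] [Module ℂ Φ] [UniformSpace Φ] [ContinuousSMul ℂ Φ]

theorem tensorMap_comp (A B A' B' : Φ →L[ℂ] Φ) :
    (tensorMap A B).comp (tensorMap A' B') = tensorMap (A.comp A') (B.comp B') :=
  CompletedTensor.ext fun a b => by
    rw [ContinuousLinearMap.comp_apply, tensorMap_coe_tmul, tensorMap_coe_tmul,
      tensorMap_coe_tmul]
    rfl

theorem tensorMap_id : tensorMap (.id ℂ Φ) (.id ℂ Φ) = .id ℂ (CompletedTensor Φ) :=
  CompletedTensor.ext fun a b => tensorMap_coe_tmul _ _ a b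

/-- `e ⊗ e` as an automorphism of `Φ ⊗̂ Φ`. -/
def tensorMapEquiv (e : Φ ≃L[ℂ] Φ) : CompletedTensor Φ ≃L[ℂ] CompletedTensor Φ :=
  .equivOfInverse (tensorMap e e) (tensorMap e.symm e.symm)
    (fun x => by
      rw [← ContinuousLinearMap.comp_apply, tensorMap_comp, e.coe_symm_comp_coe, tensorMap_id]
      rfl)
    (fun x => by
      rw [← ContinuousLinearMap.comp_apply, tensorMap_comp, e.coe_comp_coe_symm, tensorMap_id]
      rfl)

/-- `A ⊗ I - I ⊗ C A C` on `Φ ⊗̂ Φ`. -/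
def tensorCommutator (C : Φ →L⋆[ℂ] Φ) (A : Φ →L[ℂ] Φ) :
    CompletedTensor Φ →L[ℂ] CompletedTensor Φ :=
  tensorMap A (.id ℂ Φ) - tensorMap (.id ℂ Φ) (C.comp (A.comp C))

theorem tensorCommutator_coe_tmul (C : Φ →L⋆[ℂ] Φ) (A : Φ →L[ℂ] Φ) (a b : Φ) :
    tensorCommutator C A (ProjTensor.tmul a b : ProjTensor Φ) =
      (ProjTensor.tmul (A a) b : ProjTensor Φ) -
        (ProjTensor.tmul a (C (A (C b))) : ProjTensor Φ) := by
  rw [tensorCommutator, sub_apply, tensorMap_coe_tmul, tensorMap_coe_tmul]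
  rfl

theorem tensorFunctional_comp_tensorCommutator {σ : ℂ →+* ℂ} [RingHomIsometric σ]
    (C : Φ →L⋆[ℂ] Φ) (A : Φ →L[ℂ] Φ) (f g : Φ →SL[σ] ℂ) :
    (tensorFunctional f g).comp (tensorCommutator C A) =
      tensorFunctional (f.comp A) g - tensorFunctional f (g.comp (C.comp (A.comp C))) :=
  CompletedTensor.ext fun a b => by
    rw [ContinuousLinearMap.comp_apply, tensorCommutator_coe_tmul, map_sub,
      sub_apply]
    simp only [tensorFunctional_coe_tmul]
    rfl

/-- In the second factor, `C B C e = C B e C = C e A C = e C A C`, which uses the commutation with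
`C` twice. -/
theorem tensorCommutator_comp_tensorMap {C : Φ →L⋆[ℂ] Φ} {A B e : Φ →L[ℂ] Φ}
    (hAB : ∀ x, B (e x) = e (A x)) (hC : ∀ x, C (e x) = e (C x)) :
    (tensorCommutator C B).comp (tensorMap e e) = (tensorMap e e).comp (tensorCommutator C A) :=
  CompletedTensor.ext fun a b => by
    rw [ContinuousLinearMap.comp_apply, ContinuousLinearMap.comp_apply, tensorMap_coe_tmul,
      tensorCommutator_coe_tmul, tensorCommutator_coe_tmul, map_sub, tensorMap_coe_tmul,
      tensorMap_coe_tmul, hAB, hC, hAB, hC]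

end TensorMap

/-! ### Adjoint relations, closability and unitary transport. -/

section PartialOperators

variable {K : Type*} [NormedAddCommGroup K] [InnerProductSpace ℂ K]

/-- The adjoint is handled as a relation, which needs no dense domain; it can therefore be used
before closability and density are known. -/
theorem mem_submoduleAdjoint {K' : Type*} [NormedAddCommGroup K'] [InnerProductSpace ℂ K']
    {g : Submodule ℂ (K × K')} {p : K' × K} :
    p ∈ g.adjoint ↔ ∀ q ∈ g, inner ℂ q.2 p.1 = inner ℂ q.1 p.2 := by
  simp [Submodule.mem_adjoint_iff, sub_eq_zero]

theorem isClosed_submoduleAdjoint (g : Submodule ℂ (K × K)) :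
    IsClosed (g.adjoint : Set (K × K)) := by
  have : (g.adjoint : Set (K × K)) = ⋂ q ∈ g, {p | inner ℂ q.2 p.1 = inner ℂ q.1 p.2} := by
    ext p
    simp only [SetLike.mem_coe, mem_submoduleAdjoint, Set.mem_iInter, Set.mem_ofPred_eq]
  rw [this]
  exact isClosed_biInter fun q _ => isClosed_eq (by fun_prop) (by fun_prop)

theorem submoduleAdjoint_topologicalClosure (g : Submodule ℂ (K × K)) :
    g.topologicalClosure.adjoint = g.adjoint := by
  refine le_antisymm (fun p hp => ?_) fun p hp => ?_ <;> rw [mem_submoduleAdjoint] at hp ⊢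
  · exact fun q hq => hp q (g.le_topologicalClosure hq)
  · intro q hq
    have hcl : IsClosed {q : K × K | inner ℂ q.2 p.1 = inner ℂ q.1 p.2} :=
      isClosed_eq (by fun_prop) (by fun_prop)
    exact closure_minimal hp hcl hq

/-- An operator whose adjoint relation is densely defined is closable. -/
theorem isClosable_of_dense {A : K →ₗ.[ℂ] K} {s : Set K} (hs : Dense s)
    (h : ∀ x ∈ s, ∃ y, (x, y) ∈ A.graph.adjoint) : A.IsClosable := by
  refine ⟨A.graph.topologicalClosure.toLinearPMap, (Submodule.toLinearPMap_graph_eq _ ?_).symm⟩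
  intro p hp hp0
  -- A point `(0, p.2)` of the closed graph has `p.2` orthogonal to every `x` in `s`, because
  -- passing to the closure does not change the adjoint relation.
  refine hs.eq_zero_of_inner_left ℂ fun x hx => ?_
  obtain ⟨y, hy⟩ := h x hx
  rw [← submoduleAdjoint_topologicalClosure, mem_submoduleAdjoint] at hy
  rw [hy p hp, hp0, inner_zero_left]

theorem dense_domain {A : K →ₗ.[ℂ] K} {s : Set K} (hs : Dense s)
    (h : ∀ x ∈ s, ∃ y, (x, y) ∈ A.graph) : Dense (A.domain : Set K) :=
  hs.mono fun x hx => by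
    obtain ⟨y, hy⟩ := h x hx
    exact A.mem_domain_of_mem_graph hy

variable {K' : Type*} [NormedAddCommGroup K'] [InnerProductSpace ℂ K']

theorem mem_graph_unitaryConj {U : K ≃ₗᵢ[ℂ] K'} {A : K →ₗ.[ℂ] K} {p : K' × K'} :
    p ∈ (unitaryConj U A).graph ↔ (U.symm p.1, U.symm p.2) ∈ A.graph := by
  rw [LinearPMap.mem_graph_iff, LinearPMap.mem_graph_iff]
  constructor
  · rintro ⟨y, h1, h2⟩
    refine ⟨⟨U.symm y, y.2⟩, by rw [← h1], ?_⟩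
    rw [← h2]
    exact (U.symm_apply_apply _).symm
  · rintro ⟨y, h1, h2⟩
    have hy : (U y : K') = p.1 := by rw [h1, U.apply_symm_apply]
    refine ⟨⟨U y, ?_⟩, hy, ?_⟩
    · change U.symm (U y) ∈ A.domain
      rw [U.symm_apply_apply]
      exact y.2
    · rw [← U.apply_symm_apply p.2]
      refine congrArg U (Eq.trans ?_ h2)
      exact congrArg A (Subtype.ext (U.symm_apply_apply _))

theorem mem_adjoint_graph_unitaryConj {U : K ≃ₗᵢ[ℂ] K'} {A : K →ₗ.[ℂ] K} {p : K' × K'} :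
    p ∈ (unitaryConj U A).graph.adjoint ↔ (U.symm p.1, U.symm p.2) ∈ A.graph.adjoint := by
  rw [mem_submoduleAdjoint, mem_submoduleAdjoint]
  constructor
  · intro h q hq
    have := h (U q.1, U q.2) (mem_graph_unitaryConj.mpr (by simpa using hq))
    rwa [← U.symm.inner_map_map, ← U.symm.inner_map_map (U q.1), U.symm_apply_apply,
      U.symm_apply_apply] at this
  · intro h q hq
    have := h _ (mem_graph_unitaryConj.mp hq)
    rwa [U.symm.inner_map_map, U.symm.inner_map_map] at this

end PartialOperators

/-! ### Graph and adjoint relation of `C T C`. -/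

section Conjugate

variable {H : Type*} [NormedAddCommGroup H] [InnerProductSpace ℂ H] {C : H ≃ₗᵢ⋆[ℂ] H}

theorem mem_graph_of_mem_graph_conjugate (hC : ∀ x, C (C x) = x) {T : H →ₗ.[ℂ] H} {p : H × H}
    (hp : p ∈ (conjugate C T).graph) : (C p.1, C p.2) ∈ T.graph := by
  obtain ⟨y, h1, h2⟩ := (LinearPMap.mem_graph_iff _).mp hp
  refine (LinearPMap.mem_graph_iff _).mpr ⟨⟨C y, y.2⟩, by rw [← h1], ?_⟩
  rw [← h2]
  exact (hC _).symm

theorem mem_graph_conjugate (hC : ∀ x, C (C x) = x) {T : H →ₗ.[ℂ] H} {x y : H}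
    (h : (x, y) ∈ T.graph) : (C x, C y) ∈ (conjugate C T).graph := by
  obtain ⟨x, rfl, rfl⟩ := (LinearPMap.mem_graph_iff _).mp h
  refine (LinearPMap.mem_graph_iff _).mpr ⟨⟨C x, ?_⟩, rfl, ?_⟩
  · change C (C x) ∈ T.domain
    rw [hC]
    exact x.2
  · change C (T _) = C (T _)
    congr 2
    exact Subtype.ext (hC _)

/-- `C` exchanges the two arguments of the inner product (`conjugation_inner`), so complex
conjugation of the adjoint identity for `T` gives the one for `C T C`. -/
theorem mem_adjoint_graph_conjugate (hC : ∀ x, C (C x) = x) {T : H →ₗ.[ℂ] H} {x y : H}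
    (h : (x, y) ∈ T.graph.adjoint) : (C x, C y) ∈ (conjugate C T).graph.adjoint := by
  rw [mem_submoduleAdjoint] at h ⊢
  intro q hq
  have := h _ (mem_graph_of_mem_graph_conjugate hC hq)
  change inner ℂ (C q.2) x = inner ℂ (C q.1) y at this
  change inner ℂ q.2 (C x) = inner ℂ q.1 (C y)
  rw [← hC q.1, ← hC q.2, conjugation_inner, conjugation_inner, ← inner_conj_symm, this,
    inner_conj_symm]

end Conjugate

/-! ### Graph and adjoint relation of `A ⊗ I - I ⊗ B`. -/

section TensorDiff

variable {H : Type*} [NormedAddCommGroup H] [InnerProductSpace ℂ H] {A B : H →ₗ.[ℂ] H}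

theorem tensorDiff_apply (z : A.domain ⊗[ℂ] B.domain)
    (h : ((TensorProduct.map A.domain.subtype B.domain.subtype z : H ⊗[ℂ] H) : HilbertTensor H) ∈
      (tensorDiff A B).domain) :
    tensorDiff A B ⟨_, h⟩ =
      (((TensorProduct.map A.toFun B.domain.subtype - TensorProduct.map A.domain.subtype B.toFun) z :
        H ⊗[ℂ] H) : HilbertTensor H) := by
  have hinj : Function.Injective
      ((UniformSpace.Completion.toComplₗᵢ (𝕜 := ℂ) (E := H ⊗[ℂ] H)).toLinearMap ∘ₗ
        TensorProduct.map A.domain.subtype B.domain.subtype) :=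
    (UniformSpace.Completion.toComplₗᵢ (𝕜 := ℂ) (E := H ⊗[ℂ] H)).injective.comp
      (TensorProduct.map_injective_of_flat_flat _ _ A.domain.injective_subtype
        B.domain.injective_subtype)
  exact congrArg (fun w => (((TensorProduct.map A.toFun B.domain.subtype -
    TensorProduct.map A.domain.subtype B.toFun) w : H ⊗[ℂ] H) : HilbertTensor H))
    ((LinearEquiv.ofInjective _ hinj).symm_apply_apply z)

theorem mem_graph_tensorDiff {p : HilbertTensor H × HilbertTensor H} :
    p ∈ (tensorDiff A B).graph ↔ ∃ z : A.domain ⊗[ℂ] B.domain,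
      ((TensorProduct.map A.domain.subtype B.domain.subtype z : H ⊗[ℂ] H) : HilbertTensor H) = p.1 ∧
      (((TensorProduct.map A.toFun B.domain.subtype - TensorProduct.map A.domain.subtype B.toFun) z :
        H ⊗[ℂ] H) : HilbertTensor H) = p.2 := by
  rw [LinearPMap.mem_graph_iff]
  constructor
  · rintro ⟨⟨_, z, rfl⟩, h1, h2⟩
    exact ⟨z, h1, (tensorDiff_apply z _).symm.trans h2⟩
  · rintro ⟨z, h1, h2⟩
    exact ⟨⟨_, z, rfl⟩, h1, (tensorDiff_apply z _).trans h2⟩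

theorem tmul_mem_graph_tensorDiff {x x' y y' : H} (hx : (x, x') ∈ A.graph)
    (hy : (y, y') ∈ B.graph) :
    (((x ⊗ₜ[ℂ] y : H ⊗[ℂ] H) : HilbertTensor H),
      ((x' ⊗ₜ[ℂ] y : H ⊗[ℂ] H) : HilbertTensor H) - ((x ⊗ₜ[ℂ] y' : H ⊗[ℂ] H) : HilbertTensor H)) ∈
      (tensorDiff A B).graph := by
  obtain ⟨x, rfl, rfl⟩ := (LinearPMap.mem_graph_iff _).mp hx
  obtain ⟨y, rfl, rfl⟩ := (LinearPMap.mem_graph_iff _).mp hy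
  exact mem_graph_tensorDiff.mpr ⟨x ⊗ₜ y, rfl,
    UniformSpace.Completion.coe_sub (A x ⊗ₜ[ℂ] (y : H)) ((x : H) ⊗ₜ[ℂ] B y)⟩

/-- The defining identity is additive in the test tensor, and on `a ⊗ b` it factors into the
identities for `A` and `B`. -/
theorem tmul_mem_adjoint_graph_tensorDiff {x x' y y' : H} (hx : (x, x') ∈ A.graph.adjoint)
    (hy : (y, y') ∈ B.graph.adjoint) :
    (((x ⊗ₜ[ℂ] y : H ⊗[ℂ] H) : HilbertTensor H),
      ((x' ⊗ₜ[ℂ] y : H ⊗[ℂ] H) : HilbertTensor H) - ((x ⊗ₜ[ℂ] y' : H ⊗[ℂ] H) : HilbertTensor H)) ∈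
      (tensorDiff A B).graph.adjoint := by
  rw [mem_submoduleAdjoint] at hx hy ⊢
  rintro ⟨_, _⟩ hq
  obtain ⟨z, rfl, rfl⟩ := mem_graph_tensorDiff.mp hq
  simp only [← UniformSpace.Completion.coe_sub, UniformSpace.Completion.inner_coe]
  induction z using TensorProduct.induction_on with
  | zero => simp
  | add z z' h h' =>
    simp only [map_add, inner_add_left]
    rw [h (mem_graph_tensorDiff.mpr ⟨z, rfl, rfl⟩), h' (mem_graph_tensorDiff.mpr ⟨z', rfl, rfl⟩)]
  | tmul a b =>
    have ha := hx _ (A.mem_graph a)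
    have hb := hy _ (B.mem_graph b)
    simp only [LinearMap.sub_apply, TensorProduct.map_tmul, inner_sub_left, inner_sub_right,
      TensorProduct.inner_tmul, Submodule.subtype_apply]
    simp only [LinearPMap.toFun_eq_coe] at *
    rw [ha, hb]

end TensorDiff

/-! ### Restrictions to `Φ ⊗̂ Φ` of the operators on `H ⊗̄ H`. -/

section Embedding

variable {Φ : Type*} [AddCommGroup Φ] [Module ℂ Φ] [UniformSpace Φ] [ContinuousSMul ℂ Φ]
variable {H : Type*} [NormedAddCommGroup H] [InnerProductSpace ℂ H] {ι : Φ →L[ℂ] H}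

theorem denseRange_tensorEmbedding (hι : DenseRange ι) : DenseRange (tensorEmbedding ι) := by
  let S := (LinearMap.range (tensorEmbedding ι).toLinearMap).topologicalClosure
  have h1 : ∀ x y : H, ((x ⊗ₜ[ℂ] y : H ⊗[ℂ] H) : HilbertTensor H) ∈ S := by
    intro x y
    refine hι.induction_on₂ (p := fun x y => ((x ⊗ₜ[ℂ] y : H ⊗[ℂ] H) : HilbertTensor H) ∈ S)
      ?_ (fun a b => ?_) x y
    · refine (Submodule.isClosed_topologicalClosure _).preimage
        (f := fun p : H × H => ((p.1 ⊗ₜ[ℂ] p.2 : H ⊗[ℂ] H) : HilbertTensor H)) ?_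
      exact (UniformSpace.Completion.continuous_coe _).comp TensorProduct.continuous_tmul
    · exact Submodule.le_topologicalClosure _ ⟨_, tensorEmbedding_coe_tmul ι a b⟩
  have h2 : ∀ x : H ⊗[ℂ] H, (x : HilbertTensor H) ∈ S := by
    intro x
    induction x using TensorProduct.induction_on with
    | zero => simp [UniformSpace.Completion.coe_zero]
    | tmul a b => exact h1 a b
    | add x y hx hy =>
      rw [UniformSpace.Completion.coe_add]
      exact S.add_mem hx hy
  intro x
  induction x using UniformSpace.Completion.induction_on with
  | hp => exact isClosed_closure
  | ih x => exact h2 x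

/-- The `x` with this property form a closed subspace, by continuity of `S` and of the embedding.
With `M` the graph of a closed operator, this brings the whole completion into its domain, not just
`Φ ⊗ Φ`. -/
theorem mem_of_tmul_mem {M : Submodule ℂ (HilbertTensor H × HilbertTensor H)}
    (hM : IsClosed (M : Set (HilbertTensor H × HilbertTensor H)))
    {S : CompletedTensor Φ →L[ℂ] CompletedTensor Φ}
    (h : ∀ a b : Φ, (tensorEmbedding ι (ProjTensor.tmul a b : ProjTensor Φ),
      tensorEmbedding ι (S (ProjTensor.tmul a b : ProjTensor Φ))) ∈ M) (x : CompletedTensor Φ) :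
    (tensorEmbedding ι x, tensorEmbedding ι (S x)) ∈ M := by
  induction x using UniformSpace.Completion.induction_on with
  | hp =>
    exact hM.preimage ((tensorEmbedding ι).continuous.prodMk
      ((tensorEmbedding ι).continuous.comp S.continuous))
  | ih x =>
    induction x using ProjTensor.induction_on with
    | zero =>
      rw [UniformSpace.Completion.coe_zero, map_zero, map_zero, map_zero]
      exact M.zero_mem
    | tmul a b => exact h a b
    | add x y hx hy =>
      simpa only [UniformSpace.Completion.coe_add, map_add, Prod.mk_add_mk] using M.add_mem hx hy

theorem restrictsTo_etaTensor {η : H →L[ℂ] H} {ηΦ : Φ →L[ℂ] Φ} (h : ∀ φ, ι (ηΦ φ) = η (ι φ)) :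
    RestrictsTo (tensorEmbedding ι).toLinearMap (etaTensor η) (tensorMap ηΦ ηΦ) := by
  intro x
  refine (LinearPMap.mem_graph_iff _).mpr ⟨⟨tensorEmbedding ι x, trivial⟩, rfl, ?_⟩
  change (hilbertTensorMap η η).comp (tensorEmbedding ι) x =
    (tensorEmbedding ι).comp (tensorMap ηΦ ηΦ) x
  refine DFunLike.congr_fun (CompletedTensor.ext fun a b => ?_) x
  rw [ContinuousLinearMap.comp_apply, ContinuousLinearMap.comp_apply, tensorMap_coe_tmul,
    tensorEmbedding_coe_tmul, tensorEmbedding_coe_tmul, h, h]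
  exact ContinuousLinearMap.completion_apply_coe _ _

variable {C : H ≃ₗᵢ⋆[ℂ] H} {CΦ : Φ →L⋆[ℂ] Φ} {T : H →ₗ.[ℂ] H}

theorem mem_adjoint_graph_tensorDiff (hC : ∀ x, C (C x) = x) (hCΦ : ∀ φ, ι (CΦ φ) = C (ι φ))
    {S : Φ →L[ℂ] Φ} (hS : ∀ x, (ι x, ι (S x)) ∈ T.graph.adjoint) (x : CompletedTensor Φ) :
    (tensorEmbedding ι x, tensorEmbedding ι (tensorCommutator CΦ S x)) ∈
      (tensorDiff T (conjugate C T)).graph.adjoint := by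
  refine mem_of_tmul_mem (isClosed_submoduleAdjoint _) (fun a b => ?_) x
  rw [tensorCommutator_coe_tmul, map_sub]
  simp only [tensorEmbedding_coe_tmul]
  refine tmul_mem_adjoint_graph_tensorDiff (hS a) ?_
  -- Evaluating at `CΦ b` makes the conjugated pair start at `ι b`, since `C² = I`.
  have := mem_adjoint_graph_conjugate hC (hS (CΦ b))
  rwa [← hCΦ, ← hCΦ, show ι (CΦ (CΦ b)) = ι b by rw [hCΦ, hCΦ, hC]] at this

theorem isClosable_tensorDiff (hι : DenseRange ι) (hC : ∀ x, C (C x) = x)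
    (hCΦ : ∀ φ, ι (CΦ φ) = C (ι φ)) {S : Φ →L[ℂ] Φ}
    (hS : ∀ x, (ι x, ι (S x)) ∈ T.graph.adjoint) : (tensorDiff T (conjugate C T)).IsClosable := by
  refine isClosable_of_dense (denseRange_tensorEmbedding hι) ?_
  rintro _ ⟨x, rfl⟩
  exact ⟨_, mem_adjoint_graph_tensorDiff hC hCΦ hS x⟩

theorem restrictsTo_liouvilleTensor (hC : ∀ x, C (C x) = x) (hCΦ : ∀ φ, ι (CΦ φ) = C (ι φ))
    (hcl : (tensorDiff T (conjugate C T)).IsClosable)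
    {S : Φ →L[ℂ] Φ} (hS : RestrictsTo ι.toLinearMap T S) :
    RestrictsTo (tensorEmbedding ι).toLinearMap (liouvilleTensor C T) (tensorCommutator CΦ S) := by
  intro x
  refine mem_of_tmul_mem hcl.closure_isClosed (fun a b => ?_) x
  rw [tensorCommutator_coe_tmul, map_sub]
  simp only [tensorEmbedding_coe_tmul]
  refine LinearPMap.le_graph_of_le (LinearPMap.le_closure _)
    (tmul_mem_graph_tensorDiff (hS a) ?_)
  have := mem_graph_conjugate hC (hS (CΦ b))
  change (C (ι (CΦ b)), C (ι (S (CΦ b)))) ∈ _ at this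
  rwa [← hCΦ, ← hCΦ, show ι (CΦ (CΦ b)) = ι b by rw [hCΦ, hCΦ, hC]] at this

end Embedding

/-! ### Transport to `Φ_𝓛` by `I_C`. -/

section LiouvilleSpace

variable {Φ : Type*} [AddCommGroup Φ] [Module ℂ Φ] [UniformSpace Φ] [ContinuousSMul ℂ Φ]
variable {H : Type*} [NormedAddCommGroup H] [InnerProductSpace ℂ H] [CompleteSpace H]
  (C : H ≃ₗᵢ⋆[ℂ] H) {ι : Φ →L[ℂ] H}

/-- `I_C` as an isomorphism of `Φ ⊗̂ Φ` onto `Φ_𝓛`. -/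
def RiggedLiouvilleSpace.equivTensor (h : Function.Injective (tensorEmbedding ι)) :
    CompletedTensor Φ ≃L[ℂ] RiggedLiouvilleSpace C ι :=
  let e := LinearEquiv.ofBijective (ofTensor C ι)
    ⟨fun _ _ hxy => h ((liouvilleUnitary C).injective (congrArg (incl C ι) hxy)),
      LinearMap.surjective_rangeRestrict _⟩
  { e with
    continuous_toFun := continuous_coinduced_rng
    continuous_invFun := by
      -- For the coinduced topology it is enough that the composite with `ofTensor`, which is the
      -- identity, is continuous.
      refine continuous_coinduced_dom.mpr ?_
      convert continuous_id (X := CompletedTensor Φ) using 1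
      exact funext fun x => e.symm_apply_apply x }

theorem RiggedLiouvilleSpace.incl_equivTensor (h : Function.Injective (tensorEmbedding ι))
    (x : CompletedTensor Φ) :
    incl C ι (equivTensor C h x) = liouvilleUnitary C (tensorEmbedding ι x) := rfl

open RiggedLiouvilleSpace

theorem restrictsTo_incl_iff (h : Function.Injective (tensorEmbedding ι))
    {A : LiouvilleSpace H →ₗ.[ℂ] LiouvilleSpace H}
    {S : CompletedTensor Φ →L[ℂ] CompletedTensor Φ} :
    RestrictsTo (incl C ι) A ((equivTensor C h : _ →L[ℂ] _).comp
      (S.comp ((equivTensor C h).symm : _ →L[ℂ] _))) ↔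
      ∀ x, (liouvilleUnitary C (tensorEmbedding ι x),
        liouvilleUnitary C (tensorEmbedding ι (S x))) ∈ A.graph := by
  refine (equivTensor C h).surjective.forall.trans (forall_congr' fun x => ?_)
  simp only [ContinuousLinearMap.comp_apply, ContinuousLinearEquiv.coe_coe,
    ContinuousLinearEquiv.symm_apply_apply, incl_equivTensor]

theorem restrictsTo_unitaryConj (h : Function.Injective (tensorEmbedding ι))
    {A : HilbertTensor H →ₗ.[ℂ] HilbertTensor H}
    {S : CompletedTensor Φ →L[ℂ] CompletedTensor Φ}
    (hS : RestrictsTo (tensorEmbedding ι).toLinearMap A S) :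
    RestrictsTo (incl C ι) (unitaryConj (liouvilleUnitary C) A)
      ((equivTensor C h : _ →L[ℂ] _).comp (S.comp ((equivTensor C h).symm : _ →L[ℂ] _))) := by
  refine (restrictsTo_incl_iff C h).mpr fun x => mem_graph_unitaryConj.mpr ?_
  rw [LinearIsometryEquiv.symm_apply_apply, LinearIsometryEquiv.symm_apply_apply]
  exact hS x

end LiouvilleSpace

end RiggedLiouville

end

/-! ### The symmetry relations. -/

open RiggedLiouville in
theorem mainTheorem6 {H Φ : Type*} [NormedAddCommGroup H] [InnerProductSpace ℂ H] [CompleteSpace H]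
    [AddCommGroup Φ] [Module ℂ Φ] [UniformSpace Φ] [IsUniformAddGroup Φ] [ContinuousSMul ℂ Φ]
    (ι : Φ →L[ℂ] H) (hι : RiggedLiouville.IsRiggedHilbertSpace ι)
    (C : H ≃ₗᵢ⋆[ℂ] H) (hC : ∀ x, C (C x) = x)
    (CΦ : Φ →L⋆[ℂ] Φ) (hCΦ : ∀ φ, ι (CΦ φ) = C (ι φ))
    (T : H →ₗ.[ℂ] H) (TΦ : Φ →L[ℂ] Φ)
    (hTΦ : RiggedLiouville.RestrictsTo ι.toLinearMap T TΦ)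
    (η : H →L[ℂ] H) (hη : η.IsPositive) (hηinj : Function.Injective η)
    (hTη : RiggedLiouville.IsQuasiHermitian η T) (hCη : ∀ x, C (η x) = η (C x))
    (ηΦ : Φ ≃L[ℂ] Φ) (hηΦ : ∀ φ, ι (ηΦ φ) = η (ι φ)) :
    let j := (RiggedLiouville.tensorEmbedding ι).toLinearMap
    let k := RiggedLiouville.RiggedLiouvilleSpace.incl C ι
    let L := RiggedLiouville.liouvilleTensor C T
    let ℒ := RiggedLiouville.liouvillian C T
    let ηη := RiggedLiouville.etaTensor η
    let ζ := RiggedLiouville.zeta C η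
    let TdΦ := RiggedLiouville.restriction ι.toLinearMap T.adjoint
    let TdHat := RiggedLiouville.extension ι.toLinearMap T.adjoint
    let LdHat := RiggedLiouville.extension j L.adjoint
    -- the spaces are nested and all the operators extended below restrict to them
    Function.Injective j ∧
    RiggedLiouville.HasRestriction ι.toLinearMap T.adjoint ∧
    RiggedLiouville.HasRestriction j L ∧ RiggedLiouville.HasRestriction j L.adjoint ∧
    RiggedLiouville.HasRestriction j ηη ∧
    RiggedLiouville.HasRestriction k ℒ ∧ RiggedLiouville.HasRestriction k ℒ.adjoint ∧
    RiggedLiouville.HasRestriction k ζ ∧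
    -- the extension of `L†` is the extension of `T̂† ⊗ Î - Î ⊗ Ĉ T̂† Ĉ`
    LdHat = RiggedLiouville.tensorExtension TdΦ (.id ℂ Φ) (.id ℂ Φ) (CΦ.comp (TdΦ.comp CΦ)) ∧
    (∀ f g : Φ →L[ℂ] ℂ, LdHat.1 (RiggedLiouville.tensorFunctional f g) =
      RiggedLiouville.tensorFunctional (TdHat.1 f) g -
        RiggedLiouville.tensorFunctional f ((RiggedLiouville.conjHat CΦ TdHat).1 g)) ∧
    (∀ f g : Φ →L⋆[ℂ] ℂ, LdHat.2 (RiggedLiouville.tensorFunctional f g) =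
      RiggedLiouville.tensorFunctional (TdHat.2 f) g -
        RiggedLiouville.tensorFunctional f ((RiggedLiouville.conjHat CΦ TdHat).2 g)) ∧
    -- the symmetry relations: `f L̂† = ((f η̂) L̂) η̂⁻¹` with operators written to the right of a
    -- functional `f`; as a composition of maps, `L̂† = η̂⁻¹ ∘ L̂ ∘ η̂`
    (∃ u : (RiggedLiouville.DualOperator (RiggedLiouville.CompletedTensor Φ))ˣ,
      (u : RiggedLiouville.DualOperator (RiggedLiouville.CompletedTensor Φ)) =
        RiggedLiouville.extension j ηη ∧
      LdHat = ↑u⁻¹ * RiggedLiouville.extension j L * ↑u) ∧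
    (∃ u : (RiggedLiouville.DualOperator (RiggedLiouville.RiggedLiouvilleSpace C ι))ˣ,
      (u : RiggedLiouville.DualOperator (RiggedLiouville.RiggedLiouvilleSpace C ι)) =
        RiggedLiouville.extension k ζ ∧
      RiggedLiouville.extension k ℒ.adjoint = ↑u⁻¹ * RiggedLiouville.extension k ℒ * ↑u) := by
  intro j k L ℒ ηη ζ TdΦ TdHat LdHat
  have hj : Function.Injective j := hι.tensorEmbedding_injective
  have hk : Function.Injective k := Subtype.val_injective
  have hT : Dense (T.domain : Set H) := dense_domain hι.denseRange (by
    rintro _ ⟨x, rfl⟩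
    exact ⟨_, hTΦ x⟩)
  -- The restriction of `T† = η T η⁻¹` to `Φ`; it is continuous because `ηΦ` is a homeomorphism.
  let S : Φ →L[ℂ] Φ := (ηΦ : Φ →L[ℂ] Φ).comp (TΦ.comp (ηΦ.symm : Φ →L[ℂ] Φ))
  have hS : RestrictsTo ι.toLinearMap T.adjoint S := by
    intro x
    rw [hTη]
    refine ⟨_, hTΦ (ηΦ.symm x), ?_⟩
    change (η (ι _), η (ι _)) = (ι x, ι (ηΦ (TΦ (ηΦ.symm x))))
    rw [← hηΦ, ← hηΦ, ηΦ.apply_symm_apply]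
  -- The dense domain of `T` identifies the graph of the operator `T.adjoint` with the adjoint
  -- relation; the same is needed below for `L` and `ℒ`.
  have hS' : ∀ x, (ι x, ι (S x)) ∈ T.graph.adjoint := fun x => by
    rw [← LinearPMap.adjoint_graph_eq_graph_adjoint hT]
    exact hS x
  have hcl := isClosable_tensorDiff hι.denseRange hC hCΦ hS'
  have hL : RestrictsTo j L (tensorCommutator CΦ TΦ) :=
    restrictsTo_liouvilleTensor hC hCΦ hcl hTΦ
  have hLdom : Dense (L.domain : Set (HilbertTensor H)) :=
    dense_domain (denseRange_tensorEmbedding hι.denseRange) (by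
      rintro _ ⟨x, rfl⟩
      exact ⟨_, hL x⟩)
  have hLd' : ∀ x, (tensorEmbedding ι x, tensorEmbedding ι (tensorCommutator CΦ S x)) ∈
      L.graph.adjoint := fun x => by
    have hg : L.graph = (tensorDiff T (conjugate C T)).graph.topologicalClosure :=
      hcl.graph_closure_eq_closure_graph.symm
    rw [hg, submoduleAdjoint_topologicalClosure]
    exact mem_adjoint_graph_tensorDiff hC hCΦ hS' x
  have hLd : RestrictsTo j L.adjoint (tensorCommutator CΦ S) := fun x => by
    rw [LinearPMap.adjoint_graph_eq_graph_adjoint hLdom]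
    exact hLd' x
  have hηη : RestrictsTo j ηη (tensorMap (ηΦ : Φ →L[ℂ] Φ) (ηΦ : Φ →L[ℂ] Φ)) :=
    restrictsTo_etaTensor hηΦ
  let e := RiggedLiouvilleSpace.equivTensor C hj
  have hℒ : RestrictsTo k ℒ _ := restrictsTo_unitaryConj C hj hL
  have hζ : RestrictsTo k ζ _ := restrictsTo_unitaryConj C hj hηη
  have hℒdom : Dense (ℒ.domain : Set (LiouvilleSpace H)) :=
    dense_domain ((liouvilleUnitary C).surjective.denseRange.comp
      (denseRange_tensorEmbedding hι.denseRange) (liouvilleUnitary C).continuous) (by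
      rintro _ ⟨x, rfl⟩
      exact ⟨_, hℒ (e x)⟩)
  have hℒd : RestrictsTo k ℒ.adjoint ((e : _ →L[ℂ] _).comp
      ((tensorCommutator CΦ S).comp (e.symm : _ →L[ℂ] _))) := by
    refine (restrictsTo_incl_iff C hj).mpr fun x => ?_
    rw [LinearPMap.adjoint_graph_eq_graph_adjoint hℒdom]
    refine mem_adjoint_graph_unitaryConj.mpr ?_
    rw [LinearIsometryEquiv.symm_apply_apply, LinearIsometryEquiv.symm_apply_apply]
    exact hLd' x
  -- The source of both symmetry relations: `S η = η T` on `Φ`, and `C η = η C`, which descends from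
  -- `H` to `Φ` by injectivity of `ι`.
  have hcomm : (tensorCommutator CΦ S).comp (tensorMap (ηΦ : Φ →L[ℂ] Φ) (ηΦ : Φ →L[ℂ] Φ)) =
      (tensorMap (ηΦ : Φ →L[ℂ] Φ) (ηΦ : Φ →L[ℂ] Φ)).comp (tensorCommutator CΦ TΦ) := by
    refine tensorCommutator_comp_tensorMap (fun x => ?_) fun x => hι.injective ?_
    · exact congrArg (fun y => ηΦ (TΦ y)) (ηΦ.symm_apply_apply x)
    · change ι (CΦ (ηΦ x)) = ι (ηΦ (CΦ x))
      rw [hCΦ, hηΦ, hCη, hηΦ, hCΦ]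
  have hTd : TdΦ = S := hS.restriction_eq hι.injective
  have hTdHat : TdHat = hat S := hS.extension_eq hι.injective
  have hLdHat : LdHat = hat (tensorCommutator CΦ S) := hLd.extension_eq hj
  refine ⟨hj, hS.hasRestriction hι.injective, hL.hasRestriction hj, hLd.hasRestriction hj,
    hηη.hasRestriction hj, hℒ.hasRestriction hk, hℒd.hasRestriction hk, hζ.hasRestriction hk,
    ?_, fun f g => ?_, fun f g => ?_, ?_, ?_⟩
  · rw [hLdHat, hTd]
    rfl
  · rw [hLdHat, hTdHat]
    exact tensorFunctional_comp_tensorCommutator CΦ S f g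
  · rw [hLdHat, hTdHat]
    exact tensorFunctional_comp_tensorCommutator CΦ S f g
  · rw [hLdHat, hηη.extension_eq hj, hL.extension_eq hj]
    exact exists_unit_hat_conj (tensorMapEquiv ηΦ) _ _ hcomm
  · rw [hζ.extension_eq hk, hℒ.extension_eq hk, hℒd.extension_eq hk]
    -- On `Φ_𝓛` the intertwiner is `η ⊗ η` conjugated by `e`; the inner factors `e.symm ∘ e` cancel
    -- and `hcomm` remains.
    refine exists_unit_hat_conj ((e.symm.trans (tensorMapEquiv ηΦ)).trans e) _ _ ?_
    refine ContinuousLinearMap.ext fun x => ?_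
    change e (tensorCommutator CΦ S (e.symm (e (tensorMapEquiv ηΦ (e.symm x))))) =
      e (tensorMapEquiv ηΦ (e.symm (e (tensorCommutator CΦ TΦ (e.symm x)))))
    rw [e.symm_apply_apply, e.symm_apply_apply]
    exact congrArg e (DFunLike.congr_fun hcomm (e.symm x))
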